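/- Let $\mathbb{D}$ be the open unit disc, $m$ normalized Lebesgue measure on the unit circle $\mathbb{T}$, and let $H^2\subset L^2(\mathbb{T},m)$ be the Hardy space, i.e. the space of functions whose Fourier coefficients of negative index vanish, identified with the analytic functions on $\mathbb{D}$ given by their Poisson integrals. Let $\overline{H^2_0}=L^2\ominus H^2$. Let $\phi\in H^2$ be an outer function with $\|\phi\|_2=1$. Let $b:\mathbb{D}\to\mathbb{D}$, $b(0)=0$, be the analytic function generated by $\phi$, i.e. the function defined by $$\frac{1+b(z)}{1-b(z)}=\int_{\mathbb{T}}\frac{\zeta+z}{\zeta-z}\,|\phi(\zeta)|^2\,dm(\zeta),\qquad z\in\mathbb{D}.$$ For $\alpha\in\mathbb{T}$ let $\mu_\alpha$ be the associated Aleksandrov–Clark measure, i.e. the Borel probability measure on $\mathbb{T}$ such that $$\frac{1+\overline{\alpha}b(z)}{1-\overline{\alpha}b(z)}=\int_{\mathbb{T}}\frac{\zeta+z}{\zeta-z}\,d\mu_\alpha(\zeta),\qquad z\in\mathbb{D},$$ and let $(\mu_\alpha)_s$ be the singular part of $\mu_\alpha$ with respect to $m$. Let $J_\phi=\frac{H^2}{\phi}\cap\frac{\overline{H^2_0}}{\overline{\phi}}$,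 i.e. the space of all $h\in L^2(|\phi|^2dm)$ with $\phi h\in H^2$ and $\overline{\phi}h\in\overline{H^2_0}$, with the norm of $L^2(|\phi|^2dm)$. Let $L:J_\phi\to J_\phi$ be the backward shift $Lf(\zeta)=\overline{\zeta}\,(f(\zeta)-f(0))$, where $f(0)=\phi(0)^{-1}\int_{\mathbb{T}}\phi f\,dm$. The set of points of local non-exposure for $\phi$ is $\sigma(\phi)=\{\overline{\lambda}:\lambda\in\sigma(L)\}$, the complex conjugate of the spectrum of the bounded operator $L$. Then for every $\alpha\in\mathbb{T}$ the closed support of $(\mu_\alpha)_s$ is contained in $\sigma(\phi)$: $$\operatorname{supp}(\mu_\alpha)_s\subset\sigma(\phi).$$ -/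

import Mathlib

open MeasureTheory

namespace ClarkExposure

noncomputable section

/-! ### The circle, normalized Lebesgue measure and `H²` -/

instance instMeasurableSpaceCircle : MeasurableSpace Circle := borel Circle

instance instBorelSpaceCircle : BorelSpace Circle := ⟨rfl⟩

instance instFactTwoPi : Fact (0 < 2 * Real.pi) := ⟨Real.two_pi_pos⟩

/-- Normalized Lebesgue measure on the unit circle `𝕋`: the image of the normalized Haar measure
of `ℝ / 2πℤ` under `θ ↦ e^{iθ}`. -/
def m : Measure Circle :=
  Measure.map (AddCircle.toCircle (T := 2 * Real.pi))
    (AddCircle.haarAddCircle (T := 2 * Real.pi))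

instance instIsProbabilityMeasureM : IsProbabilityMeasure m :=
  Measure.isProbabilityMeasure_map
    (AddCircle.continuous_toCircle (T := 2 * Real.pi)).measurable.aemeasurable

/-- `L² = L²(𝕋, m)`. -/
abbrev L2 : Type := Lp ℂ 2 m

/-- The `n`-th Fourier coefficient `∫ ζ⁻ⁿ f(ζ) dm(ζ)`. -/
def coeff (f : Circle → ℂ) (n : ℤ) : ℂ := ∫ ζ, ((ζ ^ (-n) : Circle) : ℂ) * f ζ ∂m

lemma continuous_circle_coe : Continuous (fun ζ : Circle => (ζ : ℂ)) :=
  continuous_subtype_val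

lemma integrable_coeff (f : L2) (n : ℤ) :
    Integrable (fun ζ => ((ζ ^ (-n) : Circle) : ℂ) * f ζ) m := by
  have hf : Integrable (fun ζ => f ζ) m := (Lp.memLp f).integrable (by norm_num)
  have hc : Continuous (fun ζ : Circle => ((ζ ^ (-n) : Circle) : ℂ)) :=
    continuous_circle_coe.comp (continuous_zpow (-n))
  refine (hf.bdd_mul (c := 1) hc.aestronglyMeasurable ?_)
  filter_upwards with ζ
  exact (Circle.norm_coe _).le

lemma coeff_congr {f g : Circle → ℂ} (h : f =ᵐ[m] g) (n : ℤ) : coeff f n = coeff g n :=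
  integral_congr_ae (by filter_upwards [h] with ζ hζ; rw [hζ])

lemma coeff_zero (n : ℤ) : coeff (0 : L2) n = 0 := by
  rw [coeff_congr (Lp.coeFn_zero ℂ 2 m) n]
  simp [coeff]

lemma coeff_add (f g : L2) (n : ℤ) : coeff (f + g : L2) n = coeff f n + coeff g n := by
  rw [coeff_congr (Lp.coeFn_add f g) n]
  simp only [coeff, Pi.add_apply, mul_add]
  exact integral_add (integrable_coeff f n) (integrable_coeff g n)

lemma coeff_smul (c : ℂ) (f : L2) (n : ℤ) : coeff (c • f : L2) n = c * coeff f n := by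
  rw [coeff_congr (Lp.coeFn_smul c f) n]
  simp only [coeff, Pi.smul_apply, smul_eq_mul]
  rw [← integral_const_mul]
  exact integral_congr_ae (by filter_upwards with ζ; ring)

/-- The Hardy space `H²`, as a subspace of `L²(𝕋)` (boundary functions): the Fourier coefficients
of negative index vanish. -/
def H2 : Submodule ℂ L2 where
  carrier := {f | ∀ n : ℤ, n < 0 → coeff f n = 0}
  zero_mem' := fun n _ => coeff_zero n
  add_mem' := fun hf hg n hn => by rw [coeff_add, hf n hn, hg n hn, add_zero]
  smul_mem' := fun c f hf n hn => by rw [coeff_smul, hf n hn, mul_zero]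

/-- The space `\overline{H²₀} = L² ⊖ H²`: the Fourier coefficients of index `≥ 0` vanish. -/
def coH20 : Submodule ℂ L2 where
  carrier := {f | ∀ n : ℤ, 0 ≤ n → coeff f n = 0}
  zero_mem' := fun n _ => coeff_zero n
  add_mem' := fun hf hg n hn => by rw [coeff_add, hf n hn, hg n hn, add_zero]
  smul_mem' := fun c f hf n hn => by rw [coeff_smul, hf n hn, mul_zero]

/-- The Poisson integral `f(z) = ∫ P(z, ζ) f(ζ) dm(ζ)`, `z ∈ 𝔻`; for `f ∈ H²` it is the analytic
function on `𝔻` with boundary function `f`. -/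
def poissonExt (f : Circle → ℂ) (z : ℂ) : ℂ := ∫ ζ : Circle, (poissonKernel 0 z (ζ : ℂ) : ℂ) * f ζ ∂m

/-- `φ ∈ H²` is outer:
`φ(z) = c exp (∫ (ζ + z) / (ζ - z) log |φ(ζ)| dm(ζ))` on `𝔻`, where `|c| = 1`. -/
structure IsOuterH2 (φ : L2) : Prop where
  mem_H2 : φ ∈ H2
  integrable_log : Integrable (fun ζ => Real.log ‖φ ζ‖) m
  exists_eq_exp : ∃ c : ℂ, ‖c‖ = 1 ∧ ∀ z ∈ Metric.ball (0 : ℂ) 1,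
    poissonExt φ z =
      c * Complex.exp (∫ ζ : Circle, herglotzRieszKernel 0 z (ζ : ℂ) * (Real.log ‖φ ζ‖ : ℂ) ∂m)

lemma poissonExt_zero (f : Circle → ℂ) : poissonExt f 0 = coeff f 0 := by
  simp [poissonExt, coeff, poissonKernel_def]

lemma IsOuterH2.poissonExt_zero_ne {φ : L2} (h : IsOuterH2 φ) : poissonExt φ 0 ≠ 0 := by
  obtain ⟨c, hc, hφ⟩ := h.exists_eq_exp
  rw [hφ 0 (by simp)]
  refine mul_ne_zero ?_ (Complex.exp_ne_zero _)
  rintro rfl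
  simp at hc

/-! ### The function `b` and the Aleksandrov–Clark measures -/

/-- The Herglotz integral `∫ (ζ + z) / (ζ - z) dμ(ζ)`. -/
def herglotz (μ : Measure Circle) (z : ℂ) : ℂ := ∫ ζ : Circle, herglotzRieszKernel 0 z (ζ : ℂ) ∂μ

/-- The measure `|φ|² dm`. -/
def weight (φ : L2) : Measure Circle := m.withDensity (fun ζ => ‖φ ζ‖ₑ ^ 2)

/-- The function `b` on `𝔻` generated by `φ`: the solution of
`(1 + b(z)) / (1 - b(z)) = ∫ (ζ + z) / (ζ - z) |φ(ζ)|² dm(ζ)`. -/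
def bFun (φ : L2) (z : ℂ) : ℂ := (herglotz (weight φ) z - 1) / (herglotz (weight φ) z + 1)

/-- `μ` is the Aleksandrov–Clark measure `μ_α` of `b`: the Borel probability measure on `𝕋` with
`(1 + \bar α b(z)) / (1 - \bar α b(z)) = ∫ (ζ + z) / (ζ - z) dμ(ζ)` for all `z ∈ 𝔻`. -/
structure IsAleksandrovClark (b : ℂ → ℂ) (α : Circle) (μ : Measure Circle) : Prop where
  isProbabilityMeasure : IsProbabilityMeasure μ
  herglotz_eq : ∀ z ∈ Metric.ball (0 : ℂ) 1,
    (1 + star (α : ℂ) * b z) / (1 - star (α : ℂ) * b z) = herglotz μ z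

/-! ### The space `J_φ` inside `L²(|φ|² dm)` -/

instance instIsFiniteMeasureWeight (φ : L2) : IsFiniteMeasure (weight φ) := by
  refine isFiniteMeasure_withDensity ?_
  have h := (Lp.memLp φ).eLpNorm_lt_top
  rw [eLpNorm_lt_top_iff_lintegral_rpow_enorm_lt_top (by norm_num) (by norm_num)] at h
  simpa using h.ne

lemma ae_mul_of_ae_weight {φ : L2} {p : Circle → Prop} (h : ∀ᵐ ζ ∂(weight φ), p ζ) :
    ∀ᵐ ζ ∂m, φ ζ ≠ 0 → p ζ := by
  have hm : Measurable (fun ζ => ‖φ ζ‖ₑ ^ 2) :=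
    (Lp.stronglyMeasurable φ).measurable.enorm.pow_const 2
  have h' := (ae_withDensity_iff hm).1 h
  filter_upwards [h'] with ζ hζ h0
  exact hζ (by simpa using h0)

lemma eLpNorm_mul_weight (φ : L2) (ψ h : Circle → ℂ) (hψ : ∀ ζ, ‖ψ ζ‖ = ‖φ ζ‖) :
    eLpNorm (fun ζ => ψ ζ * h ζ) 2 m = eLpNorm h 2 (weight φ) := by
  have hm : Measurable (fun ζ => ‖φ ζ‖ₑ ^ 2) :=
    (Lp.stronglyMeasurable φ).measurable.enorm.pow_const 2
  have hψ' : ∀ ζ, ‖ψ ζ‖ₑ = ‖φ ζ‖ₑ := fun ζ => by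
    rw [← ofReal_norm, ← ofReal_norm, hψ]
  rw [eLpNorm_eq_lintegral_rpow_enorm_toReal (by norm_num) (by norm_num),
    eLpNorm_eq_lintegral_rpow_enorm_toReal (by norm_num) (by norm_num), weight,
    lintegral_withDensity_eq_lintegral_mul_non_measurable _ hm
      (by filter_upwards with ζ; exact ENNReal.pow_lt_top enorm_lt_top)]
  simp [enorm_mul, hψ', mul_pow]

lemma memLp_mul_weight (φ : L2) (ψ : Circle → ℂ) (hm : StronglyMeasurable ψ)
    (hψ : ∀ ζ, ‖ψ ζ‖ = ‖φ ζ‖) (h : Lp ℂ 2 (weight φ)) :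
    MemLp (fun ζ => ψ ζ * h ζ) 2 m :=
  ⟨(hm.mul (Lp.stronglyMeasurable h)).aestronglyMeasurable, by
    rw [eLpNorm_mul_weight φ ψ h hψ]; exact Lp.eLpNorm_lt_top h⟩

/-- Multiplication `h ↦ ψ h`, an isometry `L²(|φ|² dm) → L²`, for a function `ψ` with
`|ψ| = |φ|`. -/
def mulWeight (φ : L2) (ψ : Circle → ℂ) (hm : StronglyMeasurable ψ)
    (hψ : ∀ ζ, ‖ψ ζ‖ = ‖φ ζ‖) : Lp ℂ 2 (weight φ) →ₗᵢ[ℂ] L2 where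
  toFun h := (memLp_mul_weight φ ψ hm hψ h).toLp _
  map_add' f g := by
    rw [← MemLp.toLp_add]
    refine MemLp.toLp_congr _ _ ?_
    filter_upwards [ae_mul_of_ae_weight (Lp.coeFn_add f g)] with ζ hζ
    by_cases h0 : φ ζ = 0
    · have : ψ ζ = 0 := by rw [← norm_eq_zero, hψ, h0, norm_zero]
      simp [this]
    · change ψ ζ * (f + g : Lp ℂ 2 (weight φ)) ζ = ψ ζ * f ζ + ψ ζ * g ζ
      rw [hζ h0, Pi.add_apply, mul_add]
  map_smul' c f := by
    rw [RingHom.id_apply, ← MemLp.toLp_const_smul]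
    refine MemLp.toLp_congr _ _ ?_
    filter_upwards [ae_mul_of_ae_weight (Lp.coeFn_smul c f)] with ζ hζ
    by_cases h0 : φ ζ = 0
    · have : ψ ζ = 0 := by rw [← norm_eq_zero, hψ, h0, norm_zero]
      simp [this]
    · change ψ ζ * (c • f : Lp ℂ 2 (weight φ)) ζ = c * (ψ ζ * f ζ)
      rw [hζ h0, Pi.smul_apply, smul_eq_mul, mul_left_comm]
  norm_map' h := by
    change ‖(memLp_mul_weight φ ψ hm hψ h).toLp _‖ = ‖h‖
    rw [Lp.norm_toLp, Lp.norm_def, eLpNorm_mul_weight φ ψ h hψ]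

/-- `h ↦ φ h`. -/
def mulPhi (φ : L2) : Lp ℂ 2 (weight φ) →ₗᵢ[ℂ] L2 :=
  mulWeight φ (fun ζ => φ ζ) (Lp.stronglyMeasurable φ) (fun _ => rfl)

/-- `h ↦ \bar φ h`. -/
def mulConjPhi (φ : L2) : Lp ℂ 2 (weight φ) →ₗᵢ[ℂ] L2 :=
  mulWeight φ (fun ζ => star (φ ζ)) (Lp.stronglyMeasurable φ).star (fun _ => norm_star _)

/-- The space `J_φ = H² / φ ∩ \overline{H²₀} / \bar φ` of all `h ∈ L²(|φ|² dm)` with `φ h ∈ H²`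
and `\bar φ h ∈ \overline{H²₀}`. -/
def J (φ : L2) : Submodule ℂ (Lp ℂ 2 (weight φ)) :=
  H2.comap (mulPhi φ).toLinearMap ⊓ coH20.comap (mulConjPhi φ).toLinearMap

/-! ### The backward shift on `J_φ` and the points of local non-exposure -/

lemma eLpNorm_conjZ_mul (μ : Measure Circle) (f : Circle → ℂ) :
    eLpNorm (fun ζ : Circle => star (ζ : ℂ) * f ζ) 2 μ = eLpNorm f 2 μ :=
  eLpNorm_congr_norm_ae (by
    filter_upwards with ζ
    rw [norm_mul, norm_star, Circle.norm_coe, one_mul])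

lemma memLp_conjZ_mul (φ : L2) (f : Lp ℂ 2 (weight φ)) :
    MemLp (fun ζ : Circle => star (ζ : ℂ) * f ζ) 2 (weight φ) :=
  ⟨((continuous_star.comp continuous_circle_coe).stronglyMeasurable.mul
      (Lp.stronglyMeasurable f)).aestronglyMeasurable, by
    rw [eLpNorm_conjZ_mul]; exact Lp.eLpNorm_lt_top f⟩

/-- Multiplication by `\bar ζ` on `L²(|φ|² dm)`. -/
def mulConjZ (φ : L2) : Lp ℂ 2 (weight φ) →ₗᵢ[ℂ] Lp ℂ 2 (weight φ) where
  toFun f := (memLp_conjZ_mul φ f).toLp _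
  map_add' f g := by
    rw [← MemLp.toLp_add]
    refine MemLp.toLp_congr _ _ ?_
    filter_upwards [Lp.coeFn_add f g] with ζ hζ
    change star (ζ : ℂ) * (f + g : Lp ℂ 2 (weight φ)) ζ = star (ζ : ℂ) * f ζ + star (ζ : ℂ) * g ζ
    rw [hζ, Pi.add_apply, mul_add]
  map_smul' c f := by
    rw [RingHom.id_apply, ← MemLp.toLp_const_smul]
    refine MemLp.toLp_congr _ _ ?_
    filter_upwards [Lp.coeFn_smul c f] with ζ hζ
    change star (ζ : ℂ) * (c • f : Lp ℂ 2 (weight φ)) ζ = c * (star (ζ : ℂ) * f ζ)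
    rw [hζ, Pi.smul_apply, smul_eq_mul, mul_left_comm]
  norm_map' f := by
    change ‖(memLp_conjZ_mul φ f).toLp _‖ = ‖f‖
    rw [Lp.norm_toLp, Lp.norm_def, eLpNorm_conjZ_mul]

/-- The value at the origin, `f(0) = φ(0)⁻¹ ∫ P(0, ζ) φ(ζ) f(ζ) dm(ζ)`. -/
def evalZero (φ : L2) : Lp ℂ 2 (weight φ) →L[ℂ] ℂ :=
  (poissonExt φ 0)⁻¹ • (LinearMap.mkContinuous
    { toFun := fun g : L2 => poissonExt g 0
      map_add' := fun f g => by simp only [poissonExt_zero, coeff_add]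
      map_smul' := fun c f => by simp only [poissonExt_zero, coeff_smul]; rfl }
    1 (fun g => by
      change ‖poissonExt g 0‖ ≤ 1 * ‖g‖
      rw [poissonExt_zero, one_mul]
      have h1 : ‖coeff g 0‖ ≤ ∫ ζ, ‖g ζ‖ ∂m := by
        simpa [coeff] using norm_integral_le_integral_norm (μ := m) (fun ζ => g ζ)
      have hg : AEStronglyMeasurable (fun ζ => g ζ) m := Lp.aestronglyMeasurable g
      rw [integral_norm_eq_lintegral_enorm hg, ← eLpNorm_one_eq_lintegral_enorm] at h1
      refine h1.trans ?_
      rw [Lp.norm_def]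
      exact ENNReal.toReal_mono (Lp.eLpNorm_ne_top g)
        (eLpNorm_le_eLpNorm_of_exponent_le (by norm_num) hg))).comp
    (mulPhi φ).toContinuousLinearMap

/-- `f ↦ \bar ζ (f - f(0))` on `L²(|φ|² dm)`. -/
def shiftAux (φ : L2) : Lp ℂ 2 (weight φ) →L[ℂ] Lp ℂ 2 (weight φ) :=
  (mulConjZ φ).toContinuousLinearMap.comp
    (ContinuousLinearMap.id ℂ _ -
      (evalZero φ).smulRight (Lp.const 2 (weight φ) (1 : ℂ)))

lemma shiftAux_coeFn (φ : L2) (f : Lp ℂ 2 (weight φ)) :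
    shiftAux φ f =ᵐ[weight φ] fun ζ : Circle => star (ζ : ℂ) * (f ζ - evalZero φ f) := by
  have h1 : shiftAux φ f =ᵐ[weight φ] fun ζ : Circle => star (ζ : ℂ) *
      (f - evalZero φ f • Lp.const 2 (weight φ) (1 : ℂ) : Lp ℂ 2 (weight φ)) ζ :=
    (memLp_conjZ_mul φ _).coeFn_toLp
  refine h1.trans ?_
  filter_upwards [Lp.coeFn_sub f (evalZero φ f • Lp.const 2 (weight φ) (1 : ℂ)),
    Lp.coeFn_smul (evalZero φ f) (Lp.const 2 (weight φ) (1 : ℂ)),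
    Lp.coeFn_const (p := 2) (μ := weight φ) (1 : ℂ)] with ζ h2 h3 h4
  rw [h2, Pi.sub_apply, h3, Pi.smul_apply, h4]
  simp

lemma mulWeight_shiftAux (φ : L2) (ψ : Circle → ℂ) (hm : StronglyMeasurable ψ)
    (hψ : ∀ ζ, ‖ψ ζ‖ = ‖φ ζ‖) (f : Lp ℂ 2 (weight φ)) :
    mulWeight φ ψ hm hψ (shiftAux φ f) =ᵐ[m]
      fun ζ : Circle => star (ζ : ℂ) * (mulWeight φ ψ hm hψ f ζ - evalZero φ f * ψ ζ) := by
  have h1 : mulWeight φ ψ hm hψ (shiftAux φ f) =ᵐ[m] fun ζ => ψ ζ * shiftAux φ f ζ :=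
    (memLp_mul_weight φ ψ hm hψ _).coeFn_toLp
  have h2 : mulWeight φ ψ hm hψ f =ᵐ[m] fun ζ => ψ ζ * f ζ :=
    (memLp_mul_weight φ ψ hm hψ f).coeFn_toLp
  filter_upwards [h1, h2, ae_mul_of_ae_weight (shiftAux_coeFn φ f)] with ζ h1 h2 h3
  rw [h1, h2]
  by_cases h0 : φ ζ = 0
  · have : ψ ζ = 0 := by rw [← norm_eq_zero, hψ, h0, norm_zero]
    simp [this]
  · rw [h3 h0]; ring

lemma coeff_mulWeight_shiftAux (φ : L2) (ψ : Circle → ℂ) (hm : StronglyMeasurable ψ)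
    (hψ : ∀ ζ, ‖ψ ζ‖ = ‖φ ζ‖) (f : Lp ℂ 2 (weight φ)) (n : ℤ) :
    coeff (mulWeight φ ψ hm hψ (shiftAux φ f)) n =
      coeff (mulWeight φ ψ hm hψ f) (n + 1) - evalZero φ f * coeff ψ (n + 1) := by
  have hψL : MemLp ψ 2 m :=
    (Lp.memLp φ).of_le hm.aestronglyMeasurable (by filter_upwards with ζ; exact (hψ ζ).le)
  have e1 := coeff_congr hψL.coeFn_toLp (n + 1)
  have i2 := (integrable_coeff (hψL.toLp ψ) (n + 1)).congr
    (g := fun ζ => ((ζ ^ (-(n + 1)) : Circle) : ℂ) * ψ ζ)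
    (by filter_upwards [hψL.coeFn_toLp] with ζ hζ; rw [hζ])
  rw [coeff_congr (mulWeight_shiftAux φ ψ hm hψ f)]
  simp only [coeff]
  rw [← integral_const_mul, ← integral_sub (integrable_coeff _ _) (i2.const_mul _)]
  refine integral_congr_ae ?_
  filter_upwards with ζ
  have hz : ((ζ ^ (-(n + 1)) : Circle) : ℂ) = ((ζ ^ (-n) : Circle) : ℂ) * star (ζ : ℂ) := by
    rw [neg_add, zpow_add, zpow_neg_one, Circle.coe_mul, Circle.coe_inv_eq_conj]; rfl
  rw [hz]; ring

lemma coeff_star (f : Circle → ℂ) (n : ℤ) :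
    coeff (fun ζ => star (f ζ)) n = star (coeff f (-n)) := by
  have h : ∀ g : Circle → ℂ, star (∫ ζ, g ζ ∂m) = ∫ ζ, star (g ζ) ∂m :=
    fun g => (integral_conj (f := g) (μ := m)).symm
  rw [coeff, coeff, h]
  refine integral_congr_ae ?_
  filter_upwards with ζ
  have hz : star ((ζ ^ (-(-n)) : Circle) : ℂ) = ((ζ ^ (-n) : Circle) : ℂ) := by
    rw [zpow_neg ζ (-n), Circle.coe_inv_eq_conj]
    exact star_star _
  rw [star_mul', hz]

lemma shiftAux_mem_J {φ : L2} (hφ : IsOuterH2 φ) {f : Lp ℂ 2 (weight φ)} (hf : f ∈ J φ) :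
    shiftAux φ f ∈ J φ := by
  have hf1 : ∀ n : ℤ, n < 0 → coeff (mulPhi φ f) n = 0 := hf.1
  have hf2 : ∀ n : ℤ, 0 ≤ n → coeff (mulConjPhi φ f) n = 0 := hf.2
  have hφH : ∀ n : ℤ, n < 0 → coeff φ n = 0 := hφ.mem_H2
  have h0 : evalZero φ f * coeff φ 0 = coeff (mulPhi φ f) 0 := by
    have h1 : evalZero φ f = (poissonExt φ 0)⁻¹ * poissonExt (mulPhi φ f) 0 := rfl
    have h2 := hφ.poissonExt_zero_ne
    rw [h1, poissonExt_zero (mulPhi φ f), ← poissonExt_zero φ]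
    field_simp
  refine ⟨fun n hn => ?_, fun n hn => ?_⟩
  · change coeff (mulPhi φ (shiftAux φ f)) n = 0
    rw [mulPhi, coeff_mulWeight_shiftAux, ← mulPhi]
    rcases (show n + 1 < 0 ∨ n + 1 = 0 by omega) with h | h
    · rw [hf1 _ h, hφH _ h]; simp
    · rw [h, h0, sub_self]
  · change coeff (mulConjPhi φ (shiftAux φ f)) n = 0
    rw [mulConjPhi, coeff_mulWeight_shiftAux, ← mulConjPhi, hf2 _ (by omega), coeff_star,
      hφH _ (by omega)]
    simp

/-- The backward shift `L f = z⁻¹ (f - f(0))`, a bounded operator on `J_φ` with the norm of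
`L²(|φ|² dm)`. -/
def backwardShift (φ : L2) (hφ : IsOuterH2 φ) : J φ →L[ℂ] J φ :=
  ((shiftAux φ).comp (J φ).subtypeL).codRestrict (J φ) (fun f => shiftAux_mem_J hφ f.2)

/-- The set `σ(φ)` of points of local non-exposure for `φ`: the complex conjugate of the spectrum
of the backward shift on `J_φ`. -/
def sigma (φ : L2) (hφ : IsOuterH2 φ) : Set ℂ := star '' spectrum ℂ (backwardShift φ hφ)

end

end ClarkExposure

namespace ClarkExposure

noncomputable section

open Metric Filter Topology Complex

/-! ### Kernels on the circle and power series -/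

/-! Write `F` and `B` for the Herglotz transforms of `μ_α` and `|φ|² dm`. For `α = 1` they coincide,
so `μ_1 = |φ|² dm` has no singular part. For `α ≠ 1` the definition of `b` turns into `(F - κ)(B +
κ) = c` with `κ` purely imaginary and `c > 0`.

The first half shows that Cauchy transforms of measures `f d(μ_α)_s`, `f` bounded, lie in `J_φ`.
Jensen gives `|φ|² ≤ Re B`, so the relation yields `|φ (F - κ)|² ≤ c Re F`. Passing to boundary
values and back replaces `Re F` by the Poisson integral of the absolutely continuous part of `μ_α`
alone (`norm_sq_mul_le_poisson_rnDeriv`). If `0 ≤ ν ≤ (μ_α)_s`, an identity for the parallel sum of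
two transforms then bounds `|φ F_ν|²` by a harmonic function (`norm_sq_mul_le_of_parallel`), whence
`φ` times the Cauchy transform of `ν` is in `H²`. Since `ν` is singular, `Re F_ν` has boundary
values zero, and this is exactly what the second condition of `J_φ` requires
(`exists_mem_J_of_mul_cauchyT`).

The second half is spectral. On these Cauchy transforms `L` multiplies the density by `\bar ζ`
(`Represents.shift`). If `\bar ζ₀` is in the resolvent set, let `τ` be the part of `(μ_α)_s` whose
conjugate is carried by a small closed disc about `\bar ζ₀` inside the resolvent set. Outside the
disc `∫ (\bar ζ - w)⁻¹ dτ` is analytic; on the resolvent set it is continued by the value at the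
origin of the resolvent of `L` applied to the Cauchy transform of `τ`. The result is entire and
vanishes at infinity, hence is zero, which forces `τ = 0` (`restrict_singularPart_eq_zero`). So `ζ₀`
is outside the support. -/

lemma integral_zpow_circle (n : ℤ) :
    ∫ ζ : Circle, ((ζ ^ n : Circle) : ℂ) ∂m = if n = 0 then 1 else 0 := by
  have h1 := integral_map (μ := AddCircle.haarAddCircle (T := 2 * Real.pi))
    (AddCircle.continuous_toCircle (T := 2 * Real.pi)).measurable.aemeasurable
    (f := fun ζ : Circle => ((ζ ^ n : Circle) : ℂ))
    (continuous_circle_coe.comp (continuous_zpow n)).aestronglyMeasurable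
  refine h1.trans ?_
  have h : ∀ x : AddCircle (2 * Real.pi),
      ((AddCircle.toCircle x ^ n : Circle) : ℂ) = fourier n x := fun x => by
    rw [fourier_apply, AddCircle.toCircle_zsmul]
  simp_rw [h]
  split_ifs with h0
  · simp [h0]
  · exact integral_eq_zero_of_add_right_eq_neg (fourier_add_half_inv_index h0 Real.two_pi_pos)

lemma star_coe_pow (ζ : Circle) (n : ℕ) : star (ζ : ℂ) ^ n = ((ζ ^ (-(n : ℤ)) : Circle) : ℂ) := by
  rw [zpow_neg, Circle.coe_inv_eq_conj]; simp

lemma star_mul_coe (ζ : Circle) : star (ζ : ℂ) * (ζ : ℂ) = 1 := by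
  have := Circle.coe_inv_eq_conj ζ
  rw [show star (ζ : ℂ) = ((ζ⁻¹ : Circle) : ℂ) from this.symm, ← Circle.coe_mul]; simp

lemma norm_star_mul_lt (ζ : Circle) {z : ℂ} (hz : ‖z‖ < 1) : ‖star (ζ : ℂ) * z‖ < 1 := by
  simpa [Circle.norm_coe] using hz

lemma one_sub_star_mul_ne (ζ : Circle) {z : ℂ} (hz : ‖z‖ < 1) : 1 - star (ζ : ℂ) * z ≠ 0 := by
  intro h
  have := norm_star_mul_lt ζ hz
  rw [← sub_eq_zero.1 h] at this
  simp at this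

lemma herglotzRieszKernel_circle (ζ : Circle) {z : ℂ} (hz : ‖z‖ < 1) :
    herglotzRieszKernel 0 z (ζ : ℂ) = 2 * (1 - star (ζ : ℂ) * z)⁻¹ - 1 := by
  have h1 := one_sub_star_mul_ne ζ hz
  have h2 : (ζ : ℂ) - z ≠ 0 := by
    intro h
    rw [← sub_eq_zero.1 h, Circle.norm_coe] at hz
    exact lt_irrefl _ hz
  have h3 := star_mul_coe ζ
  rw [herglotzRieszKernel_def]
  simp only [sub_zero]
  rw [eq_sub_iff_add_eq, div_add_one h2, div_eq_iff h2, mul_assoc, eq_comm, ← div_eq_inv_mul,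
    mul_div_assoc', div_eq_iff h1]
  linear_combination (2 * z) * h3

lemma poissonKernel_circle_re (ζ : Circle) {z : ℂ} (hz : ‖z‖ < 1) :
    poissonKernel 0 z (ζ : ℂ) = 2 * ((1 - star (ζ : ℂ) * z)⁻¹).re - 1 := by
  rw [poissonKernel_eq_re_herglotzRieszKernel, Function.comp_apply,
    herglotzRieszKernel_circle ζ hz]
  simp

lemma poissonKernel_circle (ζ : Circle) {z : ℂ} (hz : ‖z‖ < 1) :
    (poissonKernel 0 z (ζ : ℂ) : ℂ) =
      (1 - star (ζ : ℂ) * z)⁻¹ + star ((1 - star (ζ : ℂ) * z)⁻¹) - 1 := by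
  rw [poissonKernel_circle_re ζ hz]
  have := Complex.add_conj ((1 - star (ζ : ℂ) * z)⁻¹)
  rw [show star ((1 - star (ζ : ℂ) * z)⁻¹) = (starRingEnd ℂ) ((1 - star (ζ : ℂ) * z)⁻¹) from rfl,
    this]
  push_cast; ring

lemma continuous_cauchyKernel {z : ℂ} (hz : ‖z‖ < 1) :
    Continuous (fun ζ : Circle => (1 - star (ζ : ℂ) * z)⁻¹) := by
  refine Continuous.inv₀ ?_ (fun ζ => one_sub_star_mul_ne ζ hz)
  exact continuous_const.sub ((continuous_star.comp continuous_circle_coe).mul continuous_const)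

lemma continuous_poissonKernel {z : ℂ} (hz : ‖z‖ < 1) :
    Continuous (fun ζ : Circle => poissonKernel 0 z (ζ : ℂ)) := by
  simp_rw [poissonKernel_circle_re _ hz]
  exact (continuous_const.mul (continuous_re.comp (continuous_cauchyKernel hz))).sub
    continuous_const

lemma integrable_continuous {μ : Measure Circle} [IsFiniteMeasure μ] {E : Type*}
    [NormedAddCommGroup E] {f : Circle → E} (hf : Continuous f) : Integrable f μ :=
  hf.integrable_of_hasCompactSupport (HasCompactSupport.of_compactSpace f)

lemma integrable_continuous_mul {μ : Measure Circle} {f g : Circle → ℂ} (hf : Continuous f)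
    (hg : Integrable g μ) : Integrable (fun ζ => f ζ * g ζ) μ := by
  obtain ⟨C, hC⟩ := isCompact_univ.exists_bound_of_continuousOn hf.continuousOn
  exact hg.bdd_mul (c := C) hf.aestronglyMeasurable (by filter_upwards with ζ; exact hC ζ trivial)

lemma integrable_continuous_mul_real {μ : Measure Circle} {f g : Circle → ℝ} (hf : Continuous f)
    (hg : Integrable g μ) : Integrable (fun ζ => f ζ * g ζ) μ := by
  obtain ⟨C, hC⟩ := isCompact_univ.exists_bound_of_continuousOn hf.continuousOn
  exact hg.bdd_mul (c := C) hf.aestronglyMeasurable (by filter_upwards with ζ; exact hC ζ trivial)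

lemma hasSum_cauchyKernel_mul {μ : Measure Circle} {f : Circle → ℂ} (hf : Integrable f μ) {z : ℂ}
    (hz : ‖z‖ < 1) :
    HasSum (fun n : ℕ => (∫ ζ : Circle, star (ζ : ℂ) ^ n * f ζ ∂μ) * z ^ n)
      (∫ ζ : Circle, (1 - star (ζ : ℂ) * z)⁻¹ * f ζ ∂μ) := by
  have key := hasSum_integral_of_dominated_convergence (μ := μ)
    (F := fun n (ζ : Circle) => (star (ζ : ℂ) * z) ^ n * f ζ)
    (f := fun ζ : Circle => (1 - star (ζ : ℂ) * z)⁻¹ * f ζ) (fun n ζ => ‖z‖ ^ n * ‖f ζ‖)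
    (fun n => ?_) (fun n => ?_) ?_ ?_ ?_
  · have e : (fun n : ℕ => (∫ ζ : Circle, star (ζ : ℂ) ^ n * f ζ ∂μ) * z ^ n) =
        fun n : ℕ => ∫ ζ : Circle, (star (ζ : ℂ) * z) ^ n * f ζ ∂μ := by
      funext n
      rw [← integral_mul_const]
      congr 1; ext ζ; ring
    rw [e]
    exact key
  · exact (((continuous_star.comp continuous_circle_coe).mul continuous_const).pow
      n).aestronglyMeasurable.mul hf.1
  · filter_upwards with ζ
    simp [Circle.norm_coe]
  · filter_upwards with ζ
    exact (summable_geometric_of_lt_one (norm_nonneg _) hz).mul_right _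
  · simp_rw [tsum_mul_right]
    exact hf.norm.const_mul _
  · filter_upwards with ζ
    exact (hasSum_geometric_of_norm_lt_one (norm_star_mul_lt ζ hz)).mul_right _

/-- The Cauchy transform `∫ (1 - \bar ζ z)⁻¹ dμ(ζ)`. -/
def cauchyT (μ : Measure Circle) (z : ℂ) : ℂ := ∫ ζ : Circle, (1 - star (ζ : ℂ) * z)⁻¹ ∂μ

lemma hasSum_cauchyT (μ : Measure Circle) [IsFiniteMeasure μ] {z : ℂ} (hz : ‖z‖ < 1) :
    HasSum (fun n : ℕ => (∫ ζ : Circle, star (ζ : ℂ) ^ n ∂μ) * z ^ n) (cauchyT μ z) := by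
  simpa [cauchyT] using hasSum_cauchyKernel_mul (integrable_const (1 : ℂ) (μ := μ)) hz

lemma herglotz_eq_cauchyT (μ : Measure Circle) [IsFiniteMeasure μ] {z : ℂ} (hz : ‖z‖ < 1) :
    herglotz μ z = 2 * cauchyT μ z - μ.real Set.univ := by
  simp_rw [herglotz, herglotzRieszKernel_circle _ hz]
  rw [integral_sub ((integrable_continuous (continuous_cauchyKernel hz)).const_mul 2)
    (integrable_const _), integral_const_mul, cauchyT]
  simp

lemma continuous_herglotzRieszKernel {z : ℂ} (hz : ‖z‖ < 1) :
    Continuous (fun ζ : Circle => herglotzRieszKernel 0 z (ζ : ℂ)) := by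
  simp_rw [herglotzRieszKernel_circle _ hz]
  exact (continuous_const.mul (continuous_cauchyKernel hz)).sub continuous_const

lemma re_herglotz (μ : Measure Circle) [IsFiniteMeasure μ] {z : ℂ} (hz : ‖z‖ < 1) :
    (herglotz μ z).re = ∫ ζ : Circle, poissonKernel 0 z (ζ : ℂ) ∂μ := by
  rw [herglotz, ← RCLike.re_eq_complex_re,
    ← integral_re (integrable_continuous (continuous_herglotzRieszKernel hz))]
  rw [poissonKernel_eq_re_herglotzRieszKernel]; rfl

lemma poissonKernel_circle_pos (ζ : Circle) {z : ℂ} (hz : ‖z‖ < 1) :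
    0 < poissonKernel 0 z (ζ : ℂ) := by
  have h2 : (ζ : ℂ) - z ≠ 0 := by
    intro h
    rw [← sub_eq_zero.1 h, Circle.norm_coe] at hz
    exact lt_irrefl _ hz
  rw [poissonKernel_def]
  simp only [sub_zero, Circle.norm_coe]
  have : ‖z‖ ^ 2 < 1 := by nlinarith [norm_nonneg z]
  have := norm_pos_iff.2 h2
  apply div_pos <;> [linarith; positivity]

lemma integral_star_pow (n : ℕ) :
    ∫ ζ : Circle, star (ζ : ℂ) ^ n ∂m = if n = 0 then 1 else 0 := by
  simp_rw [star_coe_pow, integral_zpow_circle]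
  simp

lemma integral_poissonKernel {z : ℂ} (hz : ‖z‖ < 1) :
    ∫ ζ : Circle, poissonKernel 0 z (ζ : ℂ) ∂m = 1 := by
  rw [← re_herglotz m hz, herglotz_eq_cauchyT m hz]
  have h1 := hasSum_cauchyT m hz
  simp_rw [integral_star_pow] at h1
  have h2 := hasSum_ite_eq (0 : ℕ) (1 : ℂ)
  have h3 : cauchyT m z = 1 := by
    refine h1.unique ?_
    convert h2 using 2 with n
    split_ifs with h <;> simp [h]
  rw [h3]; simp; norm_num

/-- The point `r ζ`. -/
def dil (r : ℝ) (ζ : Circle) : ℂ := r * (ζ : ℂ)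

lemma norm_dil {r : ℝ} (hr : 0 ≤ r) (ζ : Circle) : ‖dil r ζ‖ = r := by
  simp [dil, abs_of_nonneg hr, Circle.norm_coe]

lemma continuous_dil (r : ℝ) : Continuous (dil r) := continuous_const.mul continuous_circle_coe

/-- `|ξ - rζ| = |ζ - rξ|` on the circle. With Fubini, this symmetry moves Poisson integration from a
measure onto a test function. -/
lemma poissonKernel_dil_symm {r : ℝ} (ζ ξ : Circle) :
    poissonKernel 0 (dil r ζ) (ξ : ℂ) = poissonKernel 0 (dil r ξ) (ζ : ℂ) := by
  have h : ‖(ξ : ℂ) - dil r ζ‖ = ‖(ζ : ℂ) - dil r ξ‖ := by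
    have e1 : (ξ : ℂ) - dil r ζ = ξ * (1 - star (ξ : ℂ) * dil r ζ) := by
      have := star_mul_coe ξ
      linear_combination (dil r ζ) * this
    have e2 : (ζ : ℂ) - dil r ξ = ζ * star (1 - star (ξ : ℂ) * dil r ζ) := by
      have := star_mul_coe ζ
      simp only [dil, star_sub, star_mul', star_star, star_one]
      rw [show star (r : ℂ) = r from Complex.conj_ofReal r]
      linear_combination (r * ξ) * this
    rw [e1, e2, norm_mul, norm_mul, norm_star, Circle.norm_coe, Circle.norm_coe]
  have h' : ‖dil r ζ‖ = ‖dil r ξ‖ := by simp [dil, Circle.norm_coe]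
  rw [poissonKernel_def, poissonKernel_def]
  simp only [sub_zero, Circle.norm_coe, h, h']

/-- The Poisson kernel is the Cauchy kernel plus its conjugate minus one. Against `u ∈ H²` the
conjugate kernel sees only the coefficient of index zero, which the last term cancels; the Cauchy
kernel gives the power series. -/
lemma hasSum_poissonExt {u : L2} (hu : u ∈ H2) {z : ℂ} (hz : ‖z‖ < 1) :
    HasSum (fun n : ℕ => coeff u n * z ^ n) (poissonExt u z) := by
  have hi : Integrable (fun ζ => u ζ) m := (Lp.memLp u).integrable (by norm_num)
  have h1 := hasSum_cauchyKernel_mul hi hz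
  have h2 := hasSum_cauchyKernel_mul (f := fun ζ => star (u ζ))
    (Complex.conjCLE.toContinuousLinearMap.integrable_comp hi) hz
  have c1 : ∀ n : ℕ, ∫ ζ : Circle, star (ζ : ℂ) ^ n * u ζ ∂m = coeff u n := fun n => by
    simp_rw [star_coe_pow]; rfl
  have c2 : ∀ n : ℕ, ∫ ζ : Circle, star (ζ : ℂ) ^ n * star (u ζ) ∂m = star (coeff u (-n)) :=
    fun n => by
      simp_rw [star_coe_pow]; exact coeff_star u n
  simp_rw [c1] at h1
  simp_rw [c2] at h2
  have h3 : ∫ ζ : Circle, (1 - star (ζ : ℂ) * z)⁻¹ * star (u ζ) ∂m = star (coeff u 0) := by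
    refine h2.unique ?_
    convert hasSum_single (0 : ℕ) (f := fun n : ℕ => star (coeff u (-n)) * z ^ n) ?_ using 1
    · simp
    · intro n hn
      rw [hu (-n) (by omega)]; simp
  have h4 : ∫ ζ : Circle, star ((1 - star (ζ : ℂ) * z)⁻¹) * u ζ ∂m = coeff u 0 := by
    have := congrArg star h3
    rw [star_star] at this
    rw [← this, show ∀ w : ℂ, star w = (starRingEnd ℂ) w from fun _ => rfl, ← integral_conj]
    congr 1; ext ζ; simp
  have h5 : coeff u 0 = ∫ ζ, u ζ ∂m := by simp [coeff]
  have i1 := integrable_continuous_mul (continuous_cauchyKernel hz) hi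
  have i2 := integrable_continuous_mul (continuous_cauchyKernel hz).star hi
  have : poissonExt u z = ∫ ζ : Circle, (1 - star (ζ : ℂ) * z)⁻¹ * u ζ ∂m := by
    simp_rw [poissonExt, poissonKernel_circle _ hz, sub_mul, add_mul, one_mul]
    have e1 := integral_sub (i1.add i2) hi
    have e2 := integral_add i1 i2
    rw [h4, h5] at e2
    refine e1.trans ?_
    simp only [Pi.add_apply, e2]; ring
  rwa [this]

lemma differentiableOn_of_hasSum {a : ℕ → ℂ} {f : ℂ → ℂ}
    (h : ∀ z, ‖z‖ < 1 → HasSum (fun n => a n * z ^ n) (f z)) :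
    DifferentiableOn ℂ f (ball 0 1) := by
  intro z hz
  rw [mem_ball_zero_iff] at hz
  obtain ⟨r, hzr, hr⟩ := exists_between hz
  have hr0 : 0 ≤ r := (norm_nonneg z).trans hzr.le
  have hs : Summable (fun n => ‖a n‖ * r ^ n) := by
    have := (h r (by simpa [abs_of_nonneg hr0] using hr)).summable.norm
    simpa [abs_of_nonneg hr0] using this
  have hd := Complex.differentiableOn_tsum_of_summable_norm (U := ball (0 : ℂ) r)
    (F := fun n w => a n * w ^ n) hs (fun n => by fun_prop) isOpen_ball (fun n w hw => by
      rw [mem_ball_zero_iff] at hw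
      rw [norm_mul, norm_pow]; gcongr)
  have hz' : ball (0 : ℂ) r ∈ 𝓝 z := isOpen_ball.mem_nhds (by simpa using hzr)
  refine ((hd.differentiableAt hz').congr_of_eventuallyEq ?_).differentiableWithinAt
  filter_upwards [hz'] with w hw
  exact (h w (lt_trans (by simpa using hw) hr)).tsum_eq.symm

lemma differentiableOn_herglotz (μ : Measure Circle) [IsFiniteMeasure μ] :
    DifferentiableOn ℂ (herglotz μ) (ball 0 1) := by
  have h := differentiableOn_of_hasSum (fun z hz => hasSum_cauchyT μ (z := z) hz)
  exact ((h.const_mul 2).sub_const _).congr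
    (fun z hz => herglotz_eq_cauchyT μ (by simpa using hz))

lemma exists_hasSum_of_differentiableOn {f : ℂ → ℂ} (h : DifferentiableOn ℂ f (ball 0 1)) :
    ∃ a : ℕ → ℂ, ∀ z, ‖z‖ < 1 → HasSum (fun n => a n * z ^ n) (f z) := by
  refine ⟨fun n => ((n.factorial : ℂ))⁻¹ * iteratedDeriv n f 0, fun z hz => ?_⟩
  have := Complex.hasSum_taylorSeries_on_ball h (z := z) (by simpa using hz)
  simpa [mul_comm, mul_assoc, mul_left_comm] using this

/-! ### Radial limits of Poisson integrals -/

lemma continuous_poissonKernel_dil {r : ℝ} (h0 : 0 ≤ r) (h1 : r < 1) :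
    Continuous (fun p : Circle × Circle => poissonKernel 0 (dil r p.1) (p.2 : ℂ)) := by
  have h : ∀ p : Circle × Circle, ‖dil r p.1‖ < 1 := fun p => by rwa [norm_dil h0]
  have e : (fun p : Circle × Circle => poissonKernel 0 (dil r p.1) (p.2 : ℂ)) =
      fun p => 2 * ((1 - star (p.2 : ℂ) * dil r p.1)⁻¹).re - 1 :=
    funext fun p => poissonKernel_circle_re _ (h p)
  rw [e]
  have hc : Continuous (fun p : Circle × Circle => (1 - star (p.2 : ℂ) * dil r p.1)⁻¹) := by
    refine Continuous.inv₀ ?_ (fun p => one_sub_star_mul_ne _ (h p))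
    exact continuous_const.sub ((continuous_star.comp
      (continuous_circle_coe.comp continuous_snd)).mul ((continuous_dil r).comp continuous_fst))
  exact (continuous_const.mul (continuous_re.comp hc)).sub continuous_const

lemma exists_bound_poissonKernel_dil {r : ℝ} (h0 : 0 ≤ r) (h1 : r < 1) :
    ∃ C : ℝ, ∀ ζ ξ : Circle, ‖poissonKernel 0 (dil r ζ) (ξ : ℂ)‖ ≤ C := by
  obtain ⟨C, hC⟩ := isCompact_univ.exists_bound_of_continuousOn
    (continuous_poissonKernel_dil h0 h1).continuousOn
  exact ⟨C, fun ζ ξ => hC (ζ, ξ) trivial⟩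

lemma continuous_integral_poissonKernel {E : Type*} [NormedAddCommGroup E] [NormedSpace ℝ E]
    {μ : Measure Circle} {f : Circle → E} (hf : Integrable f μ) {r : ℝ} (h0 : 0 ≤ r)
    (h1 : r < 1) :
    Continuous (fun ζ : Circle => ∫ ξ : Circle, poissonKernel 0 (dil r ζ) (ξ : ℂ) • f ξ ∂μ) := by
  obtain ⟨C, hC⟩ := exists_bound_poissonKernel_dil h0 h1
  have hk := continuous_poissonKernel_dil h0 h1
  refine continuous_of_dominated (bound := fun ξ => C * ‖f ξ‖) (fun ζ => ?_) (fun ζ => ?_)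
    (hf.norm.const_mul C) ?_
  · exact (hk.comp (Continuous.prodMk_right ζ)).aestronglyMeasurable.smul hf.1
  · filter_upwards with ξ
    rw [norm_smul]
    exact mul_le_mul_of_nonneg_right (hC ζ ξ) (norm_nonneg _)
  · filter_upwards with ξ
    exact (hk.comp (Continuous.prodMk_left ξ)).smul continuous_const

lemma continuous_poissonExt_dil {f : Circle → ℂ} (hf : Integrable f m) {r : ℝ} (h0 : 0 ≤ r)
    (h1 : r < 1) : Continuous (fun ζ => poissonExt f (dil r ζ)) := by
  simpa [poissonExt] using continuous_integral_poissonKernel hf h0 h1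

lemma continuous_re_herglotz_dil (μ : Measure Circle) [IsFiniteMeasure μ] {r : ℝ} (h0 : 0 ≤ r)
    (h1 : r < 1) : Continuous (fun ζ => (herglotz μ (dil r ζ)).re) := by
  have e : ∀ ζ, (herglotz μ (dil r ζ)).re =
      ∫ ξ : Circle, poissonKernel 0 (dil r ζ) (ξ : ℂ) • (1 : ℝ) ∂μ := fun ζ => by
    rw [re_herglotz μ (by rwa [norm_dil h0])]; simp
  simp_rw [e]
  exact continuous_integral_poissonKernel (integrable_const _) h0 h1

lemma integral_mul_integral_poissonKernel {μ : Measure Circle} [IsFiniteMeasure μ]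
    {k w : Circle → ℝ} (hk : Continuous k) (hw : Integrable w μ) {r : ℝ} (h0 : 0 ≤ r)
    (h1 : r < 1) :
    ∫ ζ, k ζ * ∫ ξ : Circle, poissonKernel 0 (dil r ζ) (ξ : ℂ) * w ξ ∂μ ∂m =
      ∫ ξ, w ξ * ∫ ζ : Circle, poissonKernel 0 (dil r ξ) (ζ : ℂ) * k ζ ∂m ∂μ := by
  obtain ⟨C, hC⟩ := exists_bound_poissonKernel_dil h0 h1
  have hi : Integrable (fun p : Circle × Circle =>
      poissonKernel 0 (dil r p.1) (p.2 : ℂ) * (k p.1 * w p.2)) (m.prod μ) :=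
    ((integrable_continuous hk).mul_prod hw).bdd_mul (c := C)
      (continuous_poissonKernel_dil h0 h1).aestronglyMeasurable
      (by filter_upwards with p; exact hC p.1 p.2)
  have h2 := integral_integral_swap (f := fun ζ ξ : Circle =>
    poissonKernel 0 (dil r ζ) (ξ : ℂ) * (k ζ * w ξ)) hi
  calc _ = ∫ ζ, ∫ ξ : Circle, poissonKernel 0 (dil r ζ) (ξ : ℂ) * (k ζ * w ξ) ∂μ ∂m := by
        congr 1; ext ζ
        rw [← integral_const_mul]
        congr 1; ext ξ; ring
    _ = _ := h2
    _ = _ := by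
        congr 1; ext ξ
        rw [← integral_const_mul]
        congr 1; ext ζ
        rw [poissonKernel_dil_symm]; ring

lemma norm_poissonExt_le {f : Circle → ℂ} {z : ℂ} (hz : ‖z‖ < 1) :
    ‖poissonExt f z‖ ≤ ∫ ξ : Circle, poissonKernel 0 z (ξ : ℂ) * ‖f ξ‖ ∂m := by
  refine (norm_integral_le_integral_norm _).trans_eq ?_
  congr 1; ext ξ
  rw [norm_mul, Complex.norm_real, Real.norm_of_nonneg (poissonKernel_circle_pos ξ hz).le]

lemma integrable_poissonKernel_mul {μ : Measure Circle} {f : Circle → ℝ} (hf : Integrable f μ)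
    {z : ℂ} (hz : ‖z‖ < 1) : Integrable (fun ξ : Circle => poissonKernel 0 z (ξ : ℂ) * f ξ) μ :=
  integrable_continuous_mul_real (continuous_poissonKernel hz) hf

lemma integrable_poissonKernel_mul_complex {f : Circle → ℂ} (hf : Integrable f m)
    {z : ℂ} (hz : ‖z‖ < 1) :
    Integrable (fun ξ : Circle => (poissonKernel 0 z (ξ : ℂ) : ℂ) * f ξ) m :=
  integrable_continuous_mul (continuous_ofReal.comp (continuous_poissonKernel hz)) hf

lemma poissonExt_sub {f g : Circle → ℂ} (hf : Integrable f m) (hg : Integrable g m) {z : ℂ}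
    (hz : ‖z‖ < 1) : poissonExt (fun ζ => f ζ - g ζ) z = poissonExt f z - poissonExt g z := by
  simp_rw [poissonExt, mul_sub]
  exact integral_sub (integrable_poissonKernel_mul_complex hf hz)
    (integrable_poissonKernel_mul_complex hg hz)

lemma poissonExt_const (c : ℂ) {z : ℂ} (hz : ‖z‖ < 1) : poissonExt (fun _ => c) z = c := by
  rw [poissonExt, integral_mul_const, integral_complex_ofReal, integral_poissonKernel hz]; simp

lemma poissonKernel_dil_le {r δ : ℝ} (h0 : 0 ≤ r) (h1 : r < 1) (hδ : 0 < δ) (hr : 1 - r ≤ δ / 2)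
    {ζ ξ : Circle} (h : δ ≤ dist ξ ζ) :
    poissonKernel 0 (dil r ζ) (ξ : ℂ) ≤ 8 * (1 - r) / δ ^ 2 := by
  have hd : dist ξ ζ = ‖(ξ : ℂ) - ζ‖ := dist_eq_norm (ξ : ℂ) (ζ : ℂ)
  have h2 : ‖(ξ : ℂ) - ζ‖ ≤ ‖(ξ : ℂ) - dil r ζ‖ + (1 - r) := by
    have e : (ξ : ℂ) - ζ = ((ξ : ℂ) - dil r ζ) - ((1 - r : ℝ) : ℂ) * ζ := by
      simp only [dil]; push_cast; ring
    rw [e]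
    refine (norm_sub_le _ _).trans_eq ?_
    rw [norm_mul, Circle.norm_coe, mul_one, Complex.norm_real,
      Real.norm_of_nonneg (by linarith)]
  have h3 : δ / 2 ≤ ‖(ξ : ℂ) - dil r ζ‖ := by linarith
  rw [poissonKernel_def]
  simp only [sub_zero, Circle.norm_coe, norm_dil h0]
  have h4 : (δ / 2) ^ 2 ≤ ‖(ξ : ℂ) - dil r ζ‖ ^ 2 := by gcongr
  calc (1 ^ 2 - r ^ 2) / ‖(ξ : ℂ) - dil r ζ‖ ^ 2 ≤ (2 * (1 - r)) / (δ / 2) ^ 2 := by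
        gcongr
        nlinarith
    _ = _ := by field_simp; ring

lemma eventually_mem_Ico : ∀ᶠ r in 𝓝[<] (1 : ℝ), 0 ≤ r ∧ r < 1 := by
  have h1 : ∀ᶠ r in 𝓝[<] (1 : ℝ), r ∈ Set.Ioo (0 : ℝ) 1 := Ioo_mem_nhdsLT one_pos
  filter_upwards [h1] with r hr using ⟨hr.1.le, hr.2⟩

lemma eventually_norm_poissonExt_sub_le {f : Circle → ℂ} (hf : Continuous f) {ε : ℝ}
    (hε : 0 < ε) :
    ∀ᶠ r in 𝓝[<] (1 : ℝ), ∀ ζ, ‖poissonExt f (dil r ζ) - f ζ‖ ≤ ε := by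
  obtain ⟨δ, hδ, hfδ⟩ := Metric.uniformContinuous_iff.1
    (CompactSpace.uniformContinuous_of_continuous hf) (ε / 2) (half_pos hε)
  obtain ⟨M, hM⟩ := isCompact_univ.exists_bound_of_continuousOn hf.continuousOn
  have hM' : ∀ ζ, ‖f ζ‖ ≤ M := fun ζ => hM ζ trivial
  have hM0 : 0 ≤ M := (norm_nonneg _).trans (hM' 1)
  have t1 : ∀ᶠ r in 𝓝[<] (1 : ℝ), 1 - r < δ / 2 := by
    refine (Tendsto.mono_left ?_ nhdsWithin_le_nhds).eventually_lt_const (half_pos hδ)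
    have : Continuous fun r : ℝ => 1 - r := by fun_prop
    convert! this.tendsto 1 using 2; simp
  have t2 : ∀ᶠ r in 𝓝[<] (1 : ℝ), 8 * (1 - r) / δ ^ 2 * (2 * M) < ε / 2 := by
    refine (Tendsto.mono_left ?_ nhdsWithin_le_nhds).eventually_lt_const (half_pos hε)
    have : Continuous fun r : ℝ => 8 * (1 - r) / δ ^ 2 * (2 * M) := by fun_prop
    convert! this.tendsto 1 using 2; simp
  filter_upwards [eventually_mem_Ico, t1, t2] with r hr h1 h2 ζ
  have hz : ‖dil r ζ‖ < 1 := by rw [norm_dil hr.1]; exact hr.2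
  have hfi : Integrable f m := integrable_continuous hf
  have hci : Integrable (fun ξ => ‖f ξ - f ζ‖) m :=
    integrable_continuous (hf.sub continuous_const).norm
  rw [← poissonExt_const (f ζ) hz, ← poissonExt_sub hfi (integrable_const _) hz]
  refine (norm_poissonExt_le hz).trans ?_
  have hpi := integrable_poissonKernel_mul (integrable_const (ε / 2) (μ := m)) hz
  calc ∫ ξ : Circle, poissonKernel 0 (dil r ζ) (ξ : ℂ) * ‖f ξ - f ζ‖ ∂m
      ≤ ∫ ξ : Circle, (poissonKernel 0 (dil r ζ) (ξ : ℂ) * (ε / 2) + ε / 2) ∂m := by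
        refine integral_mono (integrable_poissonKernel_mul hci hz)
          (hpi.add (integrable_const _)) (fun ξ => ?_)
        have hp := poissonKernel_circle_pos ξ hz
        rcases lt_or_ge (dist ξ ζ) δ with h | h
        · have := (hfδ h).le
          rw [dist_eq_norm] at this
          have := mul_le_mul_of_nonneg_left this hp.le
          dsimp only
          linarith
        · have h3 := poissonKernel_dil_le hr.1 hr.2 hδ h1.le h
          have h4 : ‖f ξ - f ζ‖ ≤ 2 * M := by
            linarith [norm_sub_le (f ξ) (f ζ), hM' ξ, hM' ζ]
          have h5 := mul_le_mul h3 h4 (norm_nonneg _) (hp.le.trans h3)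
          have h6 : 0 ≤ poissonKernel 0 (dil r ζ) (ξ : ℂ) * (ε / 2) := by positivity
          dsimp only
          linarith
    _ = ε := by
        rw [integral_add hpi (integrable_const _), integral_mul_const, integral_poissonKernel hz]
        simp

/-- Poisson integration contracts `L¹` and converges uniformly on continuous functions, which are
dense. Along subsequences of radii this gives almost everywhere radial limits, enough to dispense
with Fatou's theorem. -/
lemma tendsto_integral_norm_poissonExt_sub {f : Circle → ℂ} (hf : Integrable f m) :
    Tendsto (fun r : ℝ => ∫ ζ, ‖poissonExt f (dil r ζ) - f ζ‖ ∂m) (𝓝[<] 1) (𝓝 0) := by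
  rw [Metric.tendsto_nhds]
  intro ε hε
  obtain ⟨g, hg, -⟩ := hf.exists_boundedContinuous_integral_sub_le (ε := ε / 4) (by positivity)
  have hgc : Continuous fun ζ => g ζ := g.continuous
  have hgi : Integrable (fun ζ => g ζ) m := integrable_continuous hgc
  have hfg : Integrable (fun ζ => f ζ - g ζ) m := hf.sub hgi
  filter_upwards [eventually_mem_Ico,
    eventually_norm_poissonExt_sub_le hgc (ε := ε / 4) (by positivity)] with r hr h
  have hz : ∀ ζ, ‖dil r ζ‖ < 1 := fun ζ => by rw [norm_dil hr.1]; exact hr.2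
  have hnn : 0 ≤ ∫ ζ, ‖poissonExt f (dil r ζ) - f ζ‖ ∂m := integral_nonneg fun _ => norm_nonneg _
  rw [Real.dist_eq, sub_zero, abs_of_nonneg hnn]
  have hci : Integrable (fun ζ => ∫ ξ : Circle, poissonKernel 0 (dil r ζ) (ξ : ℂ) * ‖f ξ - g ξ‖ ∂m) m :=
    integrable_continuous (by
      simpa using continuous_integral_poissonKernel hfg.norm hr.1 hr.2)
  have hci2 : Integrable (fun ζ =>
      (∫ ξ : Circle, poissonKernel 0 (dil r ζ) (ξ : ℂ) * ‖f ξ - g ξ‖ ∂m) + ε / 4) m :=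
    hci.add (integrable_const _)
  have hsw : ∫ ζ, ∫ ξ : Circle, poissonKernel 0 (dil r ζ) (ξ : ℂ) * ‖f ξ - g ξ‖ ∂m ∂m =
      ∫ ξ, ‖f ξ - g ξ‖ ∂m := by
    have := integral_mul_integral_poissonKernel (μ := m) (k := fun _ => 1) continuous_const
      hfg.norm hr.1 hr.2
    simpa [integral_poissonKernel (hz _)] using this
  calc ∫ ζ, ‖poissonExt f (dil r ζ) - f ζ‖ ∂m
      ≤ ∫ ζ, ((∫ ξ : Circle, poissonKernel 0 (dil r ζ) (ξ : ℂ) * ‖f ξ - g ξ‖ ∂m) + ε / 4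
          + ‖f ζ - g ζ‖) ∂m := by
        refine integral_mono
          ((integrable_continuous (continuous_poissonExt_dil hf hr.1 hr.2)).sub hf).norm
          (hci2.add hfg.norm) (fun ζ => ?_)
        have e : poissonExt f (dil r ζ) - f ζ = poissonExt (fun ξ => f ξ - g ξ) (dil r ζ) +
            (poissonExt g (dil r ζ) - g ζ) - (f ζ - g ζ) := by
          rw [poissonExt_sub hf hgi (hz ζ)]; ring
        dsimp only
        rw [e]
        refine (norm_sub_le _ _).trans (add_le_add_left ((norm_add_le _ _).trans ?_) _)
        exact add_le_add (norm_poissonExt_le (hz ζ)) (h ζ)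
    _ = (∫ ξ, ‖f ξ - g ξ‖ ∂m) + ε / 4 + ∫ ξ, ‖f ξ - g ξ‖ ∂m := by
        rw [integral_add hci2 hfg.norm, integral_add hci (integrable_const _), hsw]
        simp
    _ < ε := by linarith

/-- The Poisson integral of a singular measure need not tend to zero in `L¹`, as its total mass is
preserved; truncation at one turns the assertion into convergence in measure. A continuous `g` that
is close to one for `ν` and to zero for `m` separates the two measures. -/
lemma tendsto_integral_min_re_herglotz {ν : Measure Circle} [IsFiniteMeasure ν]
    (hν : ν ⟂ₘ m) :
    Tendsto (fun r : ℝ => ∫ ζ, min 1 (herglotz ν (dil r ζ)).re ∂m) (𝓝[<] 1) (𝓝 0) := by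
  obtain ⟨s, hs, hνs, hms⟩ := hν
  rw [Metric.tendsto_nhds]
  intro ε hε
  -- Here `sᶜ` carries `ν` and is `m`-null. Approximating its indicator in `L¹(m + ν)` controls both
  -- `∫ |g| dm` and `∫ |1 - g| dν` at once.
  have hind : Integrable (sᶜ.indicator fun _ => (1 : ℝ)) (m + ν) :=
    (integrable_const 1).indicator hs.compl
  obtain ⟨g, hg, -⟩ := hind.exists_boundedContinuous_integral_sub_le (ε := ε / 4) (by positivity)
  have hgc : Continuous fun ζ => g ζ := g.continuous
  have hdi : Integrable (fun ζ => ‖sᶜ.indicator (fun _ => (1 : ℝ)) ζ - g ζ‖) (m + ν) :=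
    (hind.sub (integrable_continuous hgc)).norm
  rw [integral_add_measure (hdi.mono_measure (Measure.le_add_right le_rfl))
    (hdi.mono_measure (Measure.le_add_left le_rfl))] at hg
  have e1 : ∫ ζ, ‖sᶜ.indicator (fun _ => (1 : ℝ)) ζ - g ζ‖ ∂m = ∫ ζ, |g ζ| ∂m := by
    refine integral_congr_ae ?_
    have : ∀ᵐ ζ ∂m, ζ ∉ sᶜ := measure_eq_zero_iff_ae_notMem.1 hms
    filter_upwards [this] with ζ hζ
    simp [Set.indicator_of_notMem hζ]
  have e2 : ∫ ζ, ‖sᶜ.indicator (fun _ => (1 : ℝ)) ζ - g ζ‖ ∂ν = ∫ ζ, |1 - g ζ| ∂ν := by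
    refine integral_congr_ae ?_
    have : ∀ᵐ ζ ∂ν, ζ ∉ s := measure_eq_zero_iff_ae_notMem.1 hνs
    filter_upwards [this] with ζ hζ
    rw [Set.indicator_of_mem (Set.mem_compl hζ)]; rfl
  rw [e1, e2] at hg
  have hkc : Continuous fun ζ => |1 - g ζ| := (continuous_const.sub hgc).abs
  have hkcc : Continuous fun ζ => ((|1 - g ζ| : ℝ) : ℂ) := continuous_ofReal.comp hkc
  have hν1 : 0 < 4 * (ν.real Set.univ + 1) := by positivity
  filter_upwards [eventually_mem_Ico,
    eventually_norm_poissonExt_sub_le hkcc (ε := ε / (4 * (ν.real Set.univ + 1)))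
      (by positivity)] with r hr h
  have hz : ∀ ζ, ‖dil r ζ‖ < 1 := fun ζ => by rw [norm_dil hr.1]; exact hr.2
  have hP : ∀ ζ, 0 ≤ (herglotz ν (dil r ζ)).re := fun ζ => by
    rw [re_herglotz ν (hz ζ)]
    exact integral_nonneg fun ξ => (poissonKernel_circle_pos ξ (hz ζ)).le
  have hPc := continuous_re_herglotz_dil ν hr.1 hr.2
  have hnn : 0 ≤ ∫ ζ, min 1 (herglotz ν (dil r ζ)).re ∂m :=
    integral_nonneg fun ζ => le_min zero_le_one (hP ζ)
  rw [Real.dist_eq, sub_zero, abs_of_nonneg hnn]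
  have hsw : ∫ ζ, |1 - g ζ| * (herglotz ν (dil r ζ)).re ∂m =
      ∫ ξ, ∫ ζ : Circle, poissonKernel 0 (dil r ξ) (ζ : ℂ) * |1 - g ζ| ∂m ∂ν := by
    have := integral_mul_integral_poissonKernel (μ := ν) (w := fun _ => 1) hkc
      (integrable_const _) hr.1 hr.2
    simpa [re_herglotz ν (hz _)] using this
  have hb : ∀ ξ, ∫ ζ : Circle, poissonKernel 0 (dil r ξ) (ζ : ℂ) * |1 - g ζ| ∂m ≤
      |1 - g ξ| + ε / (4 * (ν.real Set.univ + 1)) := fun ξ => by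
    have h1 := h ξ
    have h2 : poissonExt (fun ζ => ((|1 - g ζ| : ℝ) : ℂ)) (dil r ξ) =
        ((∫ ζ : Circle, poissonKernel 0 (dil r ξ) (ζ : ℂ) * |1 - g ζ| ∂m : ℝ) : ℂ) := by
      rw [← integral_complex_ofReal, poissonExt]
      congr 1; ext ζ; push_cast; rfl
    rw [h2, ← ofReal_sub, Complex.norm_real] at h1
    linarith [(abs_le.1 h1).2]
  have hmi : Integrable (fun ξ => |1 - g ξ|) ν := integrable_continuous hkc
  -- Pointwise `min 1 P ≤ |g| + |1 - g| P`, because `1 ≤ |g| + |1 - g|`; the second term is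
  -- transferred to `ν` by the symmetry of the kernel.
  calc ∫ ζ, min 1 (herglotz ν (dil r ζ)).re ∂m
      ≤ ∫ ζ, (|g ζ| + |1 - g ζ| * (herglotz ν (dil r ζ)).re) ∂m := by
        refine integral_mono (integrable_continuous (continuous_const.min hPc))
          (integrable_continuous (hgc.abs.add (hkc.mul hPc))) (fun ζ => ?_)
        have a1 : 1 ≤ |g ζ| + |1 - g ζ| := by
          have := abs_add_le (g ζ) (1 - g ζ)
          simpa using this
        have a2 := hP ζ
        have a3 := abs_nonneg (g ζ)
        have a4 := abs_nonneg (1 - g ζ)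
        dsimp only
        rcases le_total 1 (herglotz ν (dil r ζ)).re with hx | hx
        · rw [min_eq_left hx]; nlinarith
        · rw [min_eq_right hx]; nlinarith
    _ = (∫ ζ, |g ζ| ∂m) +
          ∫ ξ, ∫ ζ : Circle, poissonKernel 0 (dil r ξ) (ζ : ℂ) * |1 - g ζ| ∂m ∂ν := by
        rw [← hsw]
        exact integral_add (integrable_continuous hgc.abs) (integrable_continuous (hkc.mul hPc))
    _ ≤ (∫ ζ, |g ζ| ∂m) + ∫ ξ, (|1 - g ξ| + ε / (4 * (ν.real Set.univ + 1))) ∂ν := by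
        refine add_le_add_right
          (integral_mono (integrable_continuous ?_) (hmi.add (integrable_const _)) hb) _
        simpa using continuous_integral_poissonKernel
          (integrable_continuous hkc : Integrable _ m) hr.1 hr.2
    _ = (∫ ζ, |g ζ| ∂m) + (∫ ξ, |1 - g ξ| ∂ν) +
          ν.real Set.univ * (ε / (4 * (ν.real Set.univ + 1))) := by
        rw [integral_add hmi (integrable_const _)]
        simp [add_assoc]
    _ < ε := by
        have : ν.real Set.univ * (ε / (4 * (ν.real Set.univ + 1))) ≤ ε / 4 := by
          rw [mul_div_assoc', div_le_div_iff₀ hν1 (by norm_num)]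
          nlinarith [measureReal_nonneg (μ := ν) (s := Set.univ)]
        linarith

/-- A sequence of radii increasing to the boundary of the disc. -/
def IsRadii (r : ℕ → ℝ) : Prop := (∀ n, 0 ≤ r n ∧ r n < 1) ∧ Tendsto r atTop (𝓝 1)

lemma IsRadii.comp {r : ℕ → ℝ} (h : IsRadii r) {ns : ℕ → ℕ} (hn : StrictMono ns) :
    IsRadii (r ∘ ns) := ⟨fun n => h.1 (ns n), h.2.comp hn.tendsto_atTop⟩

lemma IsRadii.tendsto {r : ℕ → ℝ} (h : IsRadii r) : Tendsto r atTop (𝓝[<] 1) :=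
  tendsto_nhdsWithin_iff.2 ⟨h.2, Eventually.of_forall fun n => (h.1 n).2⟩

lemma IsRadii.norm_dil_lt {r : ℕ → ℝ} (h : IsRadii r) (n : ℕ) (ζ : Circle) :
    ‖dil (r n) ζ‖ < 1 := by
  rw [norm_dil (h.1 n).1]; exact (h.1 n).2

lemma exists_isRadii : ∃ r, IsRadii r := by
  refine ⟨fun n => 1 - 1 / ((n : ℝ) + 1), fun n => ⟨?_, ?_⟩, ?_⟩
  · have : 1 / ((n : ℝ) + 1) ≤ 1 := by
      rw [div_le_one (by positivity)]; linarith [(Nat.cast_nonneg n : (0 : ℝ) ≤ n)]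
    dsimp only; linarith
  · have : 0 < 1 / ((n : ℝ) + 1) := by positivity
    dsimp only; linarith
  · simpa using tendsto_const_nhds.sub (tendsto_one_div_add_atTop_nhds_zero_nat (𝕜 := ℝ))

lemma exists_subseq_tendsto_ae {E : Type*} [NormedAddCommGroup E] {F : ℕ → Circle → E}
    (hF : ∀ n, Integrable (F n) m) (h : Tendsto (fun n => ∫ ζ, ‖F n ζ‖ ∂m) atTop (𝓝 0)) :
    ∃ ns : ℕ → ℕ, StrictMono ns ∧ ∀ᵐ ζ ∂m, Tendsto (fun n => F (ns n) ζ) atTop (𝓝 0) := by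
  have h1 : TendstoInMeasure m F atTop (fun _ => (0 : E)) := by
    refine tendstoInMeasure_of_tendsto_eLpNorm one_ne_zero (fun n => (hF n).1)
      aestronglyMeasurable_const ?_
    have e : ∀ n, eLpNorm (F n - fun _ => (0 : E)) 1 m = ENNReal.ofReal (∫ ζ, ‖F n ζ‖ ∂m) :=
      fun n => by
        rw [show (F n - fun _ => (0 : E)) = F n from sub_zero _, eLpNorm_one_eq_lintegral_enorm,
          ofReal_integral_norm_eq_lintegral_enorm (hF n)]
    simp_rw [e]
    simpa using ENNReal.tendsto_ofReal h
  exact h1.exists_seq_tendsto_ae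

lemma IsRadii.exists_subseq_poissonExt {r : ℕ → ℝ} (hr : IsRadii r) {f : Circle → ℂ}
    (hf : Integrable f m) :
    ∃ ns : ℕ → ℕ, StrictMono ns ∧
      ∀ᵐ ζ ∂m, Tendsto (fun n => poissonExt f (dil (r (ns n)) ζ)) atTop (𝓝 (f ζ)) := by
  obtain ⟨ns, hns, h⟩ := exists_subseq_tendsto_ae
    (F := fun n ζ => poissonExt f (dil (r n) ζ) - f ζ)
    (fun n => (integrable_continuous (continuous_poissonExt_dil hf (hr.1 n).1 (hr.1 n).2)).sub hf)
    ((tendsto_integral_norm_poissonExt_sub hf).comp hr.tendsto)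
  refine ⟨ns, hns, ?_⟩
  filter_upwards [h] with ζ hζ
  simpa using hζ.add_const (f ζ)

lemma re_herglotz_nonneg (μ : Measure Circle) [IsFiniteMeasure μ] {z : ℂ} (hz : ‖z‖ < 1) :
    0 ≤ (herglotz μ z).re := by
  rw [re_herglotz μ hz]
  exact integral_nonneg fun ξ => (poissonKernel_circle_pos ξ hz).le

lemma IsRadii.exists_subseq_herglotz {r : ℕ → ℝ} (hr : IsRadii r) {ν : Measure Circle}
    [IsFiniteMeasure ν] (hν : ν ⟂ₘ m) :
    ∃ ns : ℕ → ℕ, StrictMono ns ∧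
      ∀ᵐ ζ ∂m, Tendsto (fun n => (herglotz ν (dil (r (ns n)) ζ)).re) atTop (𝓝 0) := by
  have hnn : ∀ n ζ, 0 ≤ min 1 (herglotz ν (dil (r n) ζ)).re := fun n ζ =>
    le_min zero_le_one (re_herglotz_nonneg ν (hr.norm_dil_lt n ζ))
  obtain ⟨ns, hns, h⟩ := exists_subseq_tendsto_ae
    (F := fun n ζ => min 1 (herglotz ν (dil (r n) ζ)).re)
    (fun n => integrable_continuous
      (continuous_const.min (continuous_re_herglotz_dil ν (hr.1 n).1 (hr.1 n).2)))
    (by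
      simp_rw [Real.norm_of_nonneg (hnn _ _)]
      exact (tendsto_integral_min_re_herglotz hν).comp hr.tendsto)
  refine ⟨ns, hns, ?_⟩
  filter_upwards [h] with ζ hζ
  refine hζ.congr' ?_
  filter_upwards [hζ.eventually_lt_const zero_lt_one] with n hn
  rcases min_lt_iff.1 hn with h1 | h1
  · exact absurd h1 (lt_irrefl _)
  · exact min_eq_right h1.le

/-! ### Hardy space: coefficients, boundary functions, means -/

lemma memLp_of_continuous {f : Circle → ℂ} (hf : Continuous f) : MemLp f 2 m := by
  obtain ⟨C, hC⟩ := isCompact_univ.exists_bound_of_continuousOn hf.continuousOn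
  exact MemLp.of_bound hf.aestronglyMeasurable C (by filter_upwards with ζ; exact hC ζ trivial)

lemma continuous_zpow_coe (n : ℤ) : Continuous (fun ζ : Circle => ((ζ ^ n : Circle) : ℂ)) :=
  continuous_circle_coe.comp (continuous_zpow n)

/-- The monomial `ζ ↦ ζⁿ` in `L²`. -/
def monomialL2 (n : ℤ) : L2 := (memLp_of_continuous (continuous_zpow_coe n)).toLp _

lemma star_coe_zpow (ζ : Circle) (n : ℤ) :
    star ((ζ ^ n : Circle) : ℂ) = ((ζ ^ (-n) : Circle) : ℂ) := by
  rw [zpow_neg, Circle.coe_inv_eq_conj]; rfl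

lemma inner_monomialL2 (n : ℤ) (f : L2) : inner ℂ (monomialL2 n) f = coeff f n := by
  rw [L2.inner_def, coeff]
  refine integral_congr_ae ?_
  filter_upwards [(memLp_of_continuous (continuous_zpow_coe n)).coeFn_toLp] with ζ hζ
  rw [monomialL2, hζ, ← star_coe_zpow, RCLike.inner_apply, mul_comm]; rfl

lemma coeff_monomialL2 (k n : ℤ) : coeff (monomialL2 k) n = if n = k then 1 else 0 := by
  rw [monomialL2, coeff_congr (memLp_of_continuous (continuous_zpow_coe k)).coeFn_toLp, coeff]
  simp_rw [← Circle.coe_mul, ← zpow_add, integral_zpow_circle]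
  congr 1
  exact propext ⟨fun h => by omega, fun h => by omega⟩

lemma orthonormal_monomialL2 : Orthonormal ℂ monomialL2 := by
  classical
  rw [orthonormal_iff_ite]
  intro i j
  rw [inner_monomialL2, coeff_monomialL2]

lemma norm_sq_L2 (f : L2) : ‖f‖ ^ 2 = ∫ ζ, ‖f ζ‖ ^ 2 ∂m := by
  have h : inner ℂ f f = ((∫ ζ, ‖f ζ‖ ^ 2 ∂m : ℝ) : ℂ) := by
    rw [L2.inner_def, ← integral_complex_ofReal]
    congr 1; ext ζ
    rw [inner_self_eq_norm_sq_to_K]; simp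
  rw [inner_self_eq_norm_sq_to_K] at h
  exact Complex.ofReal_injective (by rw [Complex.ofReal_pow]; exact h)

lemma continuous_comp_dil {U : ℂ → ℂ} (hU : DifferentiableOn ℂ U (ball 0 1)) {r : ℝ}
    (h0 : 0 ≤ r) (h1 : r < 1) : Continuous (fun ζ => U (dil r ζ)) :=
  hU.continuousOn.comp_continuous (continuous_dil r) (fun ζ => by
    rw [mem_ball_zero_iff, norm_dil h0]; exact h1)

lemma coeff_comp_dil {a : ℕ → ℂ} {U : ℂ → ℂ}
    (hU : ∀ z, ‖z‖ < 1 → HasSum (fun n => a n * z ^ n) (U z)) {r : ℝ} (h0 : 0 ≤ r) (h1 : r < 1)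
    (n : ℕ) : coeff (fun ζ => U (dil r ζ)) n = a n * r ^ n := by
  have hs : Summable (fun k => ‖a k‖ * r ^ k) := by
    have := (hU r (by simpa [abs_of_nonneg h0] using h1)).summable.norm
    simpa [abs_of_nonneg h0] using this
  have key := hasSum_integral_of_dominated_convergence (μ := m)
    (F := fun k (ζ : Circle) => ((ζ ^ (-(n : ℤ)) : Circle) : ℂ) * (a k * dil r ζ ^ k))
    (f := fun ζ : Circle => ((ζ ^ (-(n : ℤ)) : Circle) : ℂ) * U (dil r ζ))
    (fun k _ => ‖a k‖ * r ^ k)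
    (fun k => ?_) (fun k => ?_) ?_ ?_ ?_
  · refine key.unique ?_
    have e : (fun k => ∫ ζ : Circle, ((ζ ^ (-(n : ℤ)) : Circle) : ℂ) * (a k * dil r ζ ^ k) ∂m) =
        fun k => if k = n then a n * r ^ n else 0 := by
      funext k
      have : ∀ ζ : Circle, ((ζ ^ (-(n : ℤ)) : Circle) : ℂ) * (a k * dil r ζ ^ k) =
          a k * r ^ k * ((ζ ^ (-(n : ℤ) + k) : Circle) : ℂ) := fun ζ => by
        rw [zpow_add, Circle.coe_mul, zpow_natCast, Circle.coe_pow, dil, mul_pow]; ring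
      simp_rw [this]
      rw [integral_const_mul, integral_zpow_circle]
      by_cases h : k = n
      · subst h; simp
      · rw [if_neg h, if_neg (by omega), mul_zero]
    rw [e]
    exact hasSum_ite_eq n _
  · exact ((continuous_zpow_coe _).mul
      (continuous_const.mul ((continuous_dil r).pow k))).aestronglyMeasurable
  · filter_upwards with ζ
    rw [norm_mul, Circle.norm_coe, norm_mul, norm_pow, norm_dil h0, one_mul]
  · filter_upwards with ζ using hs
  · exact integrable_const _
  · filter_upwards with ζ
    exact (hU _ (by rw [norm_dil h0]; exact h1)).mul_left _

lemma integral_comp_dil {U : ℂ → ℂ} (hU : DifferentiableOn ℂ U (ball 0 1)) {r : ℝ}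
    (h0 : 0 ≤ r) (h1 : r < 1) : ∫ ζ, U (dil r ζ) ∂m = U 0 := by
  obtain ⟨a, ha⟩ := exists_hasSum_of_differentiableOn hU
  have h := coeff_comp_dil ha h0 h1 0
  have e : U 0 = a 0 := by
    refine (ha 0 (by simp)).unique ?_
    convert hasSum_single (0 : ℕ) (f := fun n : ℕ => a n * (0 : ℂ) ^ n) ?_ using 1
    · simp
    · intro n hn
      simp [hn]
  rw [e]
  simpa [coeff] using h

lemma integral_re_comp_dil {U : ℂ → ℂ} (hU : DifferentiableOn ℂ U (ball 0 1)) {r : ℝ}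
    (h0 : 0 ≤ r) (h1 : r < 1) : ∫ ζ, (U (dil r ζ)).re ∂m = (U 0).re := by
  rw [← integral_comp_dil hU h0 h1, ← RCLike.re_eq_complex_re,
    ← integral_re (integrable_continuous (continuous_comp_dil hU h0 h1))]

/-- Bessel's inequality on the circle of radius `r` bounds each finite sum of `|aₙ|² r²ⁿ` by the
mean; then `r → 1`. -/
lemma summable_norm_sq_of_mean_le {a : ℕ → ℂ} {U : ℂ → ℂ}
    (hU : ∀ z, ‖z‖ < 1 → HasSum (fun n => a n * z ^ n) (U z)) {C : ℝ}
    (hC : ∀ r : ℝ, 0 ≤ r → r < 1 → ∫ ζ, ‖U (dil r ζ)‖ ^ 2 ∂m ≤ C) :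
    Summable (fun n => ‖a n‖ ^ 2) := by
  refine summable_of_sum_le (c := C) (fun n => by positivity) (fun s => ?_)
  have h1 : ∀ᶠ r in 𝓝[<] (1 : ℝ), ∑ n ∈ s, (‖a n‖ * r ^ n) ^ 2 ≤ C := by
    filter_upwards [eventually_mem_Ico] with r hr
    have hc := continuous_comp_dil (differentiableOn_of_hasSum hU) hr.1 hr.2
    have hb := (orthonormal_monomialL2.comp (fun n : ℕ => (n : ℤ))
      Nat.cast_injective).sum_inner_products_le ((memLp_of_continuous hc).toLp _) (s := s)
    rw [norm_sq_L2] at hb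
    have e1 : ∫ ζ, ‖(memLp_of_continuous hc).toLp _ ζ‖ ^ 2 ∂m = ∫ ζ, ‖U (dil r ζ)‖ ^ 2 ∂m := by
      refine integral_congr_ae ?_
      filter_upwards [(memLp_of_continuous hc).coeFn_toLp] with ζ hζ
      rw [hζ]
    rw [e1] at hb
    refine le_trans (le_of_eq ?_) (hb.trans (hC r hr.1 hr.2))
    refine Finset.sum_congr rfl (fun n _ => ?_)
    rw [Function.comp_apply, inner_monomialL2,
      coeff_congr (memLp_of_continuous hc).coeFn_toLp, coeff_comp_dil hU hr.1 hr.2, norm_mul,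
      norm_pow, Complex.norm_real, Real.norm_of_nonneg hr.1]
  have h2 : Tendsto (fun r : ℝ => ∑ n ∈ s, (‖a n‖ * r ^ n) ^ 2) (𝓝[<] 1)
      (𝓝 (∑ n ∈ s, ‖a n‖ ^ 2)) := by
    have : Continuous (fun r : ℝ => ∑ n ∈ s, (‖a n‖ * r ^ n) ^ 2) := by fun_prop
    convert (this.tendsto 1).mono_left nhdsWithin_le_nhds using 2
    simp
  exact le_of_tendsto h2 h1

lemma exists_mem_H2_of_summable {a : ℕ → ℂ} (ha : Summable (fun n => ‖a n‖ ^ 2)) :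
    ∃ u ∈ H2, ∀ n : ℕ, coeff u n = a n := by
  have ho := orthonormal_monomialL2.comp (fun n : ℕ => (n : ℤ)) Nat.cast_injective
  have hs : Summable (fun n : ℕ => a n • monomialL2 n) := by
    have h := (ho.orthogonalFamily.summable_iff_norm_sq_summable (f := a)).2 ha
    simpa using h
  have hc : ∀ k : ℤ, HasSum (fun n : ℕ => if k = n then a n else 0)
      (coeff (∑' n : ℕ, a n • monomialL2 n : L2) k) := fun k => by
    have h := (innerSL ℂ (monomialL2 k)).hasSum hs.hasSum
    rw [innerSL_apply_apply, inner_monomialL2] at h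
    have e : (fun n : ℕ => if k = n then a n else 0) =
        fun n : ℕ => innerSL ℂ (monomialL2 k) (a n • monomialL2 n) := by
      funext n
      rw [map_smul, innerSL_apply_apply, inner_monomialL2, coeff_monomialL2]
      simp
    rw [e]
    exact h
  refine ⟨_, fun k hk => (hc k).unique ?_, fun n => (hc n).unique ?_⟩
  · convert hasSum_zero (α := ℂ) (β := ℕ) using 2 with n
    rw [if_neg (by omega)]
  · convert hasSum_ite_eq n (a n) using 2 with k
    by_cases h : k = n
    · subst h; simp
    · rw [if_neg h, if_neg (by omega)]

/-- An analytic function on the disc with bounded quadratic means is the Poisson extension of a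
function in `H²`. -/
theorem exists_mem_H2_of_mean_le {a : ℕ → ℂ} {U : ℂ → ℂ}
    (hU : ∀ z, ‖z‖ < 1 → HasSum (fun n => a n * z ^ n) (U z)) {C : ℝ}
    (hC : ∀ r : ℝ, 0 ≤ r → r < 1 → ∫ ζ, ‖U (dil r ζ)‖ ^ 2 ∂m ≤ C) :
    ∃ u ∈ H2, (∀ n : ℕ, coeff u n = a n) ∧ ∀ z, ‖z‖ < 1 → poissonExt u z = U z := by
  obtain ⟨u, hu, hua⟩ := exists_mem_H2_of_summable (summable_norm_sq_of_mean_le hU hC)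
  refine ⟨u, hu, hua, fun z hz => ?_⟩
  have h := hasSum_poissonExt hu hz
  simp_rw [hua] at h
  exact h.unique (hU z hz)

lemma integrable_L2 (u : L2) : Integrable (fun ζ => u ζ) m := (Lp.memLp u).integrable (by norm_num)

lemma integrable_norm_sq (u : L2) : Integrable (fun ζ => ‖u ζ‖ ^ 2) m :=
  (Lp.memLp u).integrable_norm_pow (by norm_num)

/-- The Poisson extension vanishes identically, and its radial limits along a sequence recover `u`.
-/
lemma eq_zero_of_coeff_eq_zero {u : L2} (hu : u ∈ H2) (h : ∀ n : ℕ, coeff u n = 0) : u = 0 := by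
  have h0 : ∀ z, ‖z‖ < 1 → poissonExt u z = 0 := fun z hz => by
    have := hasSum_poissonExt hu hz
    simp_rw [h, zero_mul] at this
    exact this.unique hasSum_zero
  obtain ⟨r, hr⟩ := exists_isRadii
  obtain ⟨ns, -, hns⟩ := hr.exists_subseq_poissonExt (integrable_L2 u)
  rw [Lp.eq_zero_iff_ae_eq_zero]
  filter_upwards [hns] with ζ hζ
  refine tendsto_nhds_unique hζ ?_
  simp_rw [h0 _ (hr.norm_dil_lt _ ζ)]
  exact tendsto_const_nhds

lemma norm_sq_poissonExt_le (u : L2) {z : ℂ} (hz : ‖z‖ < 1) :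
    ‖poissonExt u z‖ ^ 2 ≤ ∫ ξ : Circle, poissonKernel 0 z (ξ : ℂ) * ‖u ξ‖ ^ 2 ∂m := by
  have h1 := norm_poissonExt_le (f := u) hz
  set M := ∫ ξ : Circle, poissonKernel 0 z (ξ : ℂ) * ‖u ξ‖ ∂m with hM
  have i0 : Integrable (fun ξ : Circle => poissonKernel 0 z (ξ : ℂ)) m :=
    integrable_continuous (continuous_poissonKernel hz)
  have i1 := integrable_poissonKernel_mul (integrable_L2 u).norm hz
  have i2 := integrable_poissonKernel_mul (integrable_norm_sq u) hz
  -- Jensen for the square: the variance of `|u|` about its mean `M` under the probability measure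
  -- `P(z, ·) dm` is nonnegative.
  have h2 : 0 ≤ ∫ ξ : Circle, poissonKernel 0 z (ξ : ℂ) * (‖u ξ‖ - M) ^ 2 ∂m :=
    integral_nonneg fun ξ => mul_nonneg (poissonKernel_circle_pos ξ hz).le (sq_nonneg _)
  have e : ∫ ξ : Circle, poissonKernel 0 z (ξ : ℂ) * (‖u ξ‖ - M) ^ 2 ∂m =
      (∫ ξ : Circle, poissonKernel 0 z (ξ : ℂ) * ‖u ξ‖ ^ 2 ∂m) - 2 * M * M + M ^ 2 * 1 := by
    rw [← integral_poissonKernel hz]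
    nth_rewrite 3 [hM]
    rw [← integral_const_mul, ← integral_const_mul (M ^ 2)]
    have e1 := integral_sub i2 (i1.const_mul (2 * M))
    have e2 := integral_add (i2.sub (i1.const_mul (2 * M))) (i0.const_mul (M ^ 2))
    rw [← e1]
    refine Eq.trans ?_ e2
    congr 1; ext ξ
    simp only [Pi.sub_apply]
    ring
  have : M ^ 2 ≤ ∫ ξ : Circle, poissonKernel 0 z (ξ : ℂ) * ‖u ξ‖ ^ 2 ∂m := by nlinarith
  exact (pow_le_pow_left₀ (norm_nonneg _) h1 2).trans this

lemma re_herglotz_weight (φ : L2) {z : ℂ} (hz : ‖z‖ < 1) :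
    (herglotz (weight φ) z).re = ∫ ξ : Circle, poissonKernel 0 z (ξ : ℂ) * ‖φ ξ‖ ^ 2 ∂m := by
  have hm : Measurable (fun ζ => ‖φ ζ‖ₑ ^ 2) :=
    (Lp.stronglyMeasurable φ).measurable.enorm.pow_const 2
  rw [re_herglotz _ hz, weight, integral_withDensity_eq_integral_toReal_smul hm
    (by filter_upwards with ζ; exact ENNReal.pow_lt_top enorm_lt_top)]
  congr 1; ext ξ
  simp [mul_comm]

lemma norm_sq_poissonExt_le_re_herglotz (φ : L2) {z : ℂ} (hz : ‖z‖ < 1) :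
    ‖poissonExt φ z‖ ^ 2 ≤ (herglotz (weight φ) z).re := by
  rw [re_herglotz_weight φ hz]
  exact norm_sq_poissonExt_le φ hz

lemma differentiableOn_poissonExt {u : L2} (hu : u ∈ H2) :
    DifferentiableOn ℂ (poissonExt u) (ball 0 1) :=
  differentiableOn_of_hasSum fun _ hz => hasSum_poissonExt hu hz

/-- An outer function vanishes almost nowhere on the circle. -/
lemma IsOuterH2.ae_ne_zero {φ : L2} (hφ : IsOuterH2 φ) : ∀ᵐ ζ ∂m, φ ζ ≠ 0 := by
  obtain ⟨c, hc, hφc⟩ := hφ.exists_eq_exp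
  have hlog : Integrable (fun ζ => (Real.log ‖φ ζ‖ : ℂ)) m := hφ.integrable_log.ofReal
  obtain ⟨r, hr⟩ := exists_isRadii
  obtain ⟨n1, hn1, h1⟩ := hr.exists_subseq_poissonExt (integrable_L2 φ)
  obtain ⟨n2, hn2, h2⟩ := (hr.comp hn1).exists_subseq_poissonExt hlog
  have key : ∀ z, ‖z‖ < 1 → ‖poissonExt φ z‖ =
      Real.exp (poissonExt (fun ζ => (Real.log ‖φ ζ‖ : ℂ)) z).re := fun z hz => by
    rw [hφc z (by simpa using hz), norm_mul, hc, one_mul, Complex.norm_exp]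
    congr 1
    have i1 : Integrable (fun ζ : Circle => herglotzRieszKernel 0 z (ζ : ℂ) * (Real.log ‖φ ζ‖ : ℂ)) m :=
      integrable_continuous_mul (continuous_herglotzRieszKernel hz) hlog
    rw [poissonExt, ← RCLike.re_eq_complex_re, ← integral_re i1,
      ← integral_re (integrable_poissonKernel_mul_complex hlog hz)]
    congr 1; ext ζ
    rw [poissonKernel_eq_re_herglotzRieszKernel]
    simp
  filter_upwards [h1, h2] with ζ h1 h2 h0
  have t1 := (h1.comp hn2.tendsto_atTop).norm
  have t2 := (Real.continuous_exp.tendsto _).comp ((continuous_re.tendsto _).comp h2)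
  -- The convention `Real.log 0 = 0` means that integrability of the logarithm alone does not
  -- exclude zeros. The outer formula does: the radial limit of `|φ(z)|` is an exponential, hence
  -- positive.
  have e : ‖φ ζ‖ = Real.exp ((Real.log ‖φ ζ‖ : ℂ)).re :=
    tendsto_nhds_unique t1 (t2.congr fun n => (key _ (hr.norm_dil_lt _ ζ)).symm)
  rw [h0, norm_zero] at e
  exact (Real.exp_pos _).ne e

lemma isClosed_H2 : IsClosed (H2 : Set L2) := by
  have : (H2 : Set L2) = ⋂ n : ℤ, ⋂ _ : n < 0, {f | inner ℂ (monomialL2 n) f = 0} := by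
    ext f
    simp only [Set.mem_iInter, Set.mem_ofPred_eq, inner_monomialL2]
    rfl
  rw [this]
  exact isClosed_iInter fun n => isClosed_iInter fun _ =>
    isClosed_eq (by fun_prop) continuous_const

lemma isClosed_coH20 : IsClosed (coH20 : Set L2) := by
  have : (coH20 : Set L2) = ⋂ n : ℤ, ⋂ _ : 0 ≤ n, {f | inner ℂ (monomialL2 n) f = 0} := by
    ext f
    simp only [Set.mem_iInter, Set.mem_ofPred_eq, inner_monomialL2]
    rfl
  rw [this]
  exact isClosed_iInter fun n => isClosed_iInter fun _ =>
    isClosed_eq (by fun_prop) continuous_const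

instance instCompleteSpaceJ (φ : L2) : CompleteSpace (J φ) := by
  have h : IsClosed (J φ : Set (Lp ℂ 2 (weight φ))) :=
    (isClosed_H2.preimage (mulPhi φ).continuous).inter
      (isClosed_coH20.preimage (mulConjPhi φ).continuous)
  exact h.completeSpace_coe

/-! ### Singular parts of Aleksandrov–Clark measures and `J_φ` -/

lemma hasSum_mul_antidiagonal {a b : ℕ → ℂ} {A B z : ℂ} (ha : HasSum (fun n => a n * z ^ n) A)
    (hb : HasSum (fun n => b n * z ^ n) B) :
    HasSum (fun n => (∑ p ∈ Finset.HasAntidiagonal.antidiagonal n, a p.1 * b p.2) * z ^ n) (A * B) := by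
  have e : (fun n => (∑ p ∈ Finset.HasAntidiagonal.antidiagonal n, a p.1 * b p.2) * z ^ n) =
      fun n => ∑ p ∈ Finset.HasAntidiagonal.antidiagonal n, (a p.1 * z ^ p.1) * (b p.2 * z ^ p.2) := by
    funext n
    rw [Finset.sum_mul]
    refine Finset.sum_congr rfl (fun p hp => ?_)
    rw [← Finset.HasAntidiagonal.mem_antidiagonal.1 hp, pow_add]; ring
  have hs := summable_norm_sum_mul_antidiagonal_of_summable_norm ha.summable.norm hb.summable.norm
  rw [e, ← ha.tsum_eq, ← hb.tsum_eq,
    tsum_mul_tsum_eq_tsum_sum_antidiagonal_of_summable_norm ha.summable.norm hb.summable.norm]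
  exact hs.of_norm.hasSum

lemma herglotz_add (μ ν : Measure Circle) [IsFiniteMeasure μ] [IsFiniteMeasure ν] {z : ℂ}
    (hz : ‖z‖ < 1) : herglotz (μ + ν) z = herglotz μ z + herglotz ν z :=
  integral_add_measure (integrable_continuous (continuous_herglotzRieszKernel hz))
    (integrable_continuous (continuous_herglotzRieszKernel hz))

lemma re_herglotz_withDensity (μ : Measure Circle) [IsFiniteMeasure μ] {z : ℂ} (hz : ‖z‖ < 1) :
    (herglotz (m.withDensity (μ.rnDeriv m)) z).re =
      ∫ ξ : Circle, poissonKernel 0 z (ξ : ℂ) * (μ.rnDeriv m ξ).toReal ∂m := by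
  rw [re_herglotz _ hz, integral_withDensity_eq_integral_toReal_smul (μ.measurable_rnDeriv m)
    (μ.rnDeriv_lt_top m)]
  congr 1; ext ξ
  simp [mul_comm]

lemma ofReal_integral_poissonKernel_mul (g : Circle → ℝ) (z : ℂ) :
    ((∫ ξ : Circle, poissonKernel 0 z (ξ : ℂ) * g ξ ∂m : ℝ) : ℂ) =
      poissonExt (fun ξ => (g ξ : ℂ)) z := by
  rw [← integral_complex_ofReal, poissonExt]
  congr 1; ext ζ; push_cast; rfl

/-- A finite measure is determined by its Herglotz transform. -/
lemma eq_of_herglotz_eq {μ ν : Measure Circle} [IsFiniteMeasure μ] [IsFiniteMeasure ν]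
    (h : ∀ z, ‖z‖ < 1 → herglotz μ z = herglotz ν z) : μ = ν := by
  -- The measures `Re (herglotz ρ)(rζ) dm(ζ)` converge weakly to `ρ`, so the transform determines
  -- all integrals of continuous functions.
  have key : ∀ (ρ : Measure Circle) [IsFiniteMeasure ρ] (k : Circle → ℝ) (_ : Continuous k),
      Tendsto (fun r => ∫ ζ, k ζ * (herglotz ρ (dil r ζ)).re ∂m) (𝓝[<] 1) (𝓝 (∫ ζ, k ζ ∂ρ)) := by
    intro ρ _ k hk
    rw [Metric.tendsto_nhds]
    intro ε hε
    have hρ : 0 < 2 * (ρ.real Set.univ + 1) := by positivity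
    filter_upwards [eventually_mem_Ico, eventually_norm_poissonExt_sub_le
      (f := fun ζ => (k ζ : ℂ)) (continuous_ofReal.comp hk)
      (ε := ε / (2 * (ρ.real Set.univ + 1))) (by positivity)] with r hr hb
    have hz : ∀ ζ, ‖dil r ζ‖ < 1 := fun ζ => by rw [norm_dil hr.1]; exact hr.2
    have hsw : ∫ ζ, k ζ * (herglotz ρ (dil r ζ)).re ∂m =
        ∫ ξ, ∫ ζ : Circle, poissonKernel 0 (dil r ξ) (ζ : ℂ) * k ζ ∂m ∂ρ := by
      have := integral_mul_integral_poissonKernel (μ := ρ) (w := fun _ => 1) hk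
        (integrable_const _) hr.1 hr.2
      simpa [re_herglotz ρ (hz _)] using this
    have hc : Continuous fun ξ => ∫ ζ : Circle, poissonKernel 0 (dil r ξ) (ζ : ℂ) * k ζ ∂m := by
      simpa using continuous_integral_poissonKernel
        (integrable_continuous hk : Integrable _ m) hr.1 hr.2
    rw [hsw, dist_eq_norm, ← integral_sub (integrable_continuous hc) (integrable_continuous hk)]
    refine (norm_integral_le_of_norm_le_const (C := ε / (2 * (ρ.real Set.univ + 1))) ?_).trans_lt ?_
    · filter_upwards with ξ
      have := hb ξ
      rwa [← ofReal_integral_poissonKernel_mul, ← ofReal_sub, Complex.norm_real] at this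
    · rw [div_mul_eq_mul_div, div_lt_iff₀ hρ]
      nlinarith [measureReal_nonneg (μ := ρ) (s := Set.univ)]
  refine ext_of_forall_integral_eq_of_IsFiniteMeasure (fun f => ?_)
  refine tendsto_nhds_unique (key μ f f.continuous) ((key ν f f.continuous).congr' ?_)
  filter_upwards [eventually_mem_Ico] with r hr
  congr 1; ext ζ
  rw [h _ (by rw [norm_dil hr.1]; exact hr.2)]

/-! ### Quadratic estimates for `φ` times Herglotz transforms -/

section Estimate

variable {φ : L2} {μ : Measure Circle} {κ : ℂ} {c : ℝ}

/-- With `A = F - κ` and `B + κ = c / A`, multiplication by the conjugate of `A` gives `|A|² Re B =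
c Re A`, as `κ` is imaginary. It remains to use `|φ|² ≤ Re B`. -/
lemma norm_sq_mul_le_re_herglotz (hκ : κ.re = 0)
    (hrel : ∀ z, ‖z‖ < 1 → (herglotz μ z - κ) * (herglotz (weight φ) z + κ) = c)
    {z : ℂ} (hz : ‖z‖ < 1) :
    ‖poissonExt φ z * (herglotz μ z - κ)‖ ^ 2 ≤ c * (herglotz μ z).re := by
  have h1 := norm_sq_poissonExt_le_re_herglotz φ hz
  have h2 := hrel z hz
  set A := herglotz μ z - κ with hA
  set B := herglotz (weight φ) z + κ with hB
  have hAre : (herglotz μ z).re = A.re := by simp [hA, hκ]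
  have hBre : (herglotz (weight φ) z).re = B.re := by simp [hB, hκ]
  have h3 : ‖A‖ ^ 2 * B.re = c * A.re := by
    have h4 : (starRingEnd ℂ A * A) * B = starRingEnd ℂ A * c := by rw [mul_assoc, h2]
    rw [Complex.conj_mul'] at h4
    have := congrArg Complex.re h4
    rw [← ofReal_pow, re_ofReal_mul, re_mul_ofReal, conj_re] at this
    linarith
  rw [norm_mul, mul_pow, hAre, ← h3, mul_comm]
  rw [hBre] at h1
  gcongr

variable [IsFiniteMeasure μ]

/-- The previous bound puts `φ (F - κ)` in `H²`. On the boundary the singular part of `μ`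
contributes nothing to `Re F`, so the boundary function `ψ` satisfies `|ψ|² ≤ c dμ/dm`; Jensen
carries this back into the disc with the singular part removed. -/
lemma norm_sq_mul_le_poisson_rnDeriv (hφ : φ ∈ H2) (hκ : κ.re = 0)
    (hrel : ∀ z, ‖z‖ < 1 → (herglotz μ z - κ) * (herglotz (weight φ) z + κ) = c)
    {z : ℂ} (hz : ‖z‖ < 1) :
    ‖poissonExt φ z * (herglotz μ z - κ)‖ ^ 2 ≤
      c * (herglotz (m.withDensity (μ.rnDeriv m)) z).re := by
  have hd : DifferentiableOn ℂ (fun z => poissonExt φ z * (herglotz μ z - κ)) (ball 0 1) :=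
    (differentiableOn_poissonExt hφ).mul ((differentiableOn_herglotz μ).sub_const _)
  have hdF := differentiableOn_herglotz μ
  obtain ⟨a, ha⟩ := exists_hasSum_of_differentiableOn hd
  obtain ⟨ψ, hψ, -, hψe⟩ := exists_mem_H2_of_mean_le ha (C := c * (herglotz μ 0).re) (by
    intro r h0 h1
    rw [← integral_re_comp_dil hdF h0 h1, ← integral_const_mul]
    refine integral_mono (integrable_continuous ((continuous_comp_dil hd h0 h1).norm.pow 2))
      (integrable_continuous (continuous_const.mul
        (continuous_re.comp (continuous_comp_dil hdF h0 h1)))) (fun ζ => ?_)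
    exact norm_sq_mul_le_re_herglotz hκ hrel (by rw [norm_dil h0]; exact h1))
  have hg : Integrable (fun ξ => (μ.rnDeriv m ξ).toReal) m := Measure.integrable_toReal_rnDeriv
  obtain ⟨r, hr⟩ := exists_isRadii
  obtain ⟨n1, hn1, t1⟩ := hr.exists_subseq_poissonExt (integrable_L2 ψ)
  obtain ⟨n2, hn2, t2⟩ := (hr.comp hn1).exists_subseq_herglotz (μ.mutuallySingular_singularPart m)
  have hr2 := (hr.comp hn1).comp hn2
  obtain ⟨n3, hn3, t3⟩ := hr2.exists_subseq_poissonExt hg.ofReal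
  have hr3 := hr2.comp hn3
  -- Successive subsequences of radii make `ψ`, the singular part and the density converge
  -- simultaneously.
  have hψg : ∀ᵐ ζ ∂m, ‖ψ ζ‖ ^ 2 ≤ c * (μ.rnDeriv m ζ).toReal := by
    filter_upwards [t1, t2, t3] with ζ t1 t2 t3
    have s1 := ((t1.comp hn2.tendsto_atTop).comp hn3.tendsto_atTop).norm.pow 2
    have s2 := ((t2.comp hn3.tendsto_atTop).add ((continuous_re.tendsto _).comp t3)).const_mul c
    rw [zero_add] at s2
    refine le_of_tendsto_of_tendsto' s1 s2 (fun n => ?_)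
    have hz := hr3.norm_dil_lt n ζ
    have h1 := norm_sq_mul_le_re_herglotz hκ hrel hz
    rw [← hψe _ hz] at h1
    refine h1.trans_eq ?_
    have h2 := congrArg (fun ρ => (herglotz ρ (dil ((((r ∘ n1) ∘ n2) ∘ n3) n) ζ)).re)
      (μ.haveLebesgueDecomposition_add m)
    have h3 : (poissonExt (fun ξ => ((μ.rnDeriv m ξ).toReal : ℂ))
        (dil ((((r ∘ n1) ∘ n2) ∘ n3) n) ζ)).re =
        (herglotz (m.withDensity (μ.rnDeriv m)) (dil ((((r ∘ n1) ∘ n2) ∘ n3) n) ζ)).re := by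
      rw [← ofReal_integral_poissonKernel_mul, ofReal_re, re_herglotz_withDensity μ hz]
    refine congrArg (c * ·) (h2.trans ?_)
    simp only [Function.comp_apply] at h3 hz ⊢
    rw [herglotz_add _ _ hz, add_re]
    exact congrArg _ h3.symm
  rw [← hψe z hz, re_herglotz_withDensity μ hz]
  refine (norm_sq_poissonExt_le ψ hz).trans ?_
  rw [← integral_const_mul]
  refine integral_mono_ae (integrable_poissonKernel_mul (integrable_norm_sq ψ) hz)
    ((integrable_poissonKernel_mul hg hz).const_mul c) ?_
  filter_upwards [hψg] with ζ hζ
  have := mul_le_mul_of_nonneg_left hζ (poissonKernel_circle_pos ζ hz).le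
  linarith

/-- The quotient on the right is the parallel sum of `K` and `G - κ`. Its real part times `|K + G -
κ|²` equals `Re K |G - κ|² + Re G |K|²`; the first term is dropped and the hypothesis is applied to
the second. The gain is an upper bound that is the real part of an analytic function when `K` and
`G` are analytic. -/
lemma norm_sq_mul_le_of_parallel {p K G : ℂ} (hK : 0 ≤ K.re) (hκ : κ.re = 0) (hc : 0 < c)
    (hD : K + G - κ ≠ 0) (h : ‖p * (K + G - κ)‖ ^ 2 ≤ c * G.re) :
    ‖p * K‖ ^ 2 ≤ c * (K * (G - κ) / (K + G - κ)).re := by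
  have hn : 0 < ‖K + G - κ‖ ^ 2 := by have := norm_pos_iff.2 hD; positivity
  have e : (K * (G - κ) / (K + G - κ)).re * ‖K + G - κ‖ ^ 2 =
      K.re * ‖G - κ‖ ^ 2 + G.re * ‖K‖ ^ 2 := by
    have h1 : K * (G - κ) / (K + G - κ) * (‖K + G - κ‖ ^ 2 : ℝ) =
        K * (‖G - κ‖ ^ 2 : ℝ) + (G - κ) * (‖K‖ ^ 2 : ℝ) := by
      push_cast
      rw [← Complex.mul_conj', ← Complex.mul_conj', ← Complex.mul_conj', ← mul_assoc,
        div_mul_cancel₀ _ hD]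
      simp only [map_sub, map_add]
      ring
    have h2 := congrArg Complex.re h1
    rw [re_mul_ofReal, add_re, re_mul_ofReal, re_mul_ofReal, sub_re, hκ, sub_zero] at h2
    exact h2
  rw [norm_mul, mul_pow] at h ⊢
  refine le_of_mul_le_mul_right ?_ hn
  rw [mul_assoc c, e]
  have a1 := mul_le_mul_of_nonneg_right h (sq_nonneg ‖K‖)
  have a2 : 0 ≤ c * (K.re * ‖G - κ‖ ^ 2) := by positivity
  nlinarith

lemma exists_mem_H2_mul_cauchyT_of_parallel (hφ : φ ∈ H2) {ν σ : Measure Circle}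
    [IsFiniteMeasure ν] [IsFiniteMeasure σ]
    (hD : ∀ z, ‖z‖ < 1 → herglotz ν z + herglotz σ z - κ ≠ 0)
    (hle : ∀ z, ‖z‖ < 1 → ‖poissonExt φ z * herglotz ν z‖ ^ 2 ≤ c *
      (herglotz ν z * (herglotz σ z - κ) / (herglotz ν z + herglotz σ z - κ)).re) :
    ∃ u ∈ H2, (∀ n : ℕ, coeff u n = ∑ p ∈ Finset.HasAntidiagonal.antidiagonal n,
        coeff φ p.1 * ∫ ζ : Circle, star (ζ : ℂ) ^ p.2 ∂ν) ∧
      ∀ z, ‖z‖ < 1 → poissonExt u z = poissonExt φ z * cauchyT ν z := by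
  obtain ⟨N, hN⟩ : ∃ N : ℝ, N = ν.real Set.univ := ⟨_, rfl⟩
  -- The Cauchy transform is `(F_ν + N) / 2`, and `|x + y|² / 4 ≤ (|x|² + |y|²) / 2` produces the
  -- two weights. `W` is analytic and `Re W` dominates `|φ C_ν|²`, so all quadratic means are at
  -- most `Re W(0)`.
  obtain ⟨W, hW⟩ : ∃ W : ℂ → ℂ, W = fun z => ((c / 2 : ℝ) : ℂ) *
    (herglotz ν z * (herglotz σ z - κ) / (herglotz ν z + herglotz σ z - κ)) +
      ((N ^ 2 / 2 : ℝ) : ℂ) * herglotz (weight φ) z := ⟨_, rfl⟩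
  have hWd : DifferentiableOn ℂ W (ball 0 1) := by
    have d1 := differentiableOn_herglotz ν
    have d2 := differentiableOn_herglotz σ
    have d3 := differentiableOn_herglotz (weight φ)
    rw [hW]
    exact (((d1.mul (d2.sub_const _)).div ((d1.add d2).sub_const _)
      (fun z hz => hD z (by simpa using hz))).const_mul _).add (d3.const_mul _)
  have hs : ∀ z, ‖z‖ < 1 →
      HasSum (fun n : ℕ => (∑ p ∈ Finset.HasAntidiagonal.antidiagonal n,
        coeff φ p.1 * ∫ ζ : Circle, star (ζ : ℂ) ^ p.2 ∂ν) * z ^ n)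
      (poissonExt φ z * cauchyT ν z) := fun z hz =>
    hasSum_mul_antidiagonal (a := fun n : ℕ => coeff φ n)
      (b := fun n : ℕ => ∫ ζ : Circle, star (ζ : ℂ) ^ n ∂ν) (hasSum_poissonExt hφ hz)
      (hasSum_cauchyT ν hz)
  have hb : ∀ z, ‖z‖ < 1 → ‖poissonExt φ z * cauchyT ν z‖ ^ 2 ≤ (W z).re := by
    intro z hz
    have e1 : poissonExt φ z * cauchyT ν z =
        (poissonExt φ z * herglotz ν z + poissonExt φ z * N) / 2 := by
      rw [herglotz_eq_cauchyT ν hz, hN]; ring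
    have e2 := norm_add_le (poissonExt φ z * herglotz ν z) (poissonExt φ z * N)
    have e3 : ‖poissonExt φ z * N‖ ^ 2 = N ^ 2 * ‖poissonExt φ z‖ ^ 2 := by
      rw [norm_mul, mul_pow, Complex.norm_real, Real.norm_eq_abs, sq_abs, mul_comm]
    have e4 := norm_sq_poissonExt_le_re_herglotz φ hz
    have e5 := mul_le_mul_of_nonneg_left e4 (sq_nonneg N)
    have e6 := hle z hz
    have e7 : (W z).re = c / 2 * (herglotz ν z * (herglotz σ z - κ) /
        (herglotz ν z + herglotz σ z - κ)).re +
        N ^ 2 / 2 * (herglotz (weight φ) z).re := by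
      rw [hW]
      dsimp only
      rw [add_re, re_ofReal_mul, re_ofReal_mul]
    rw [e1, e7, norm_div, div_pow, show ‖(2 : ℂ)‖ ^ 2 = 4 by norm_num]
    have e8 := pow_le_pow_left₀ (norm_nonneg _) e2 2
    have e9 := sq_nonneg (‖poissonExt φ z * herglotz ν z‖ - ‖poissonExt φ z * N‖)
    linarith
  refine exists_mem_H2_of_mean_le hs (C := (W 0).re) (fun r h0 h1 => ?_)
  rw [← integral_re_comp_dil hWd h0 h1]
  exact integral_mono
    (integrable_continuous
      ((continuous_comp_dil (differentiableOn_of_hasSum hs) h0 h1).norm.pow 2))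
    (integrable_continuous (continuous_re.comp (continuous_comp_dil hWd h0 h1)))
    (fun ζ => hb _ (by rw [norm_dil h0]; exact h1))

/-- For `ν ≤ (μ_α)_s`, the product of `φ` and the Cauchy transform of `ν` belongs to `H²`. -/
lemma exists_mem_H2_mul_cauchyT (hφ : φ ∈ H2) (hκ : κ.re = 0) (hc : 0 < c)
    (hrel : ∀ z, ‖z‖ < 1 → (herglotz μ z - κ) * (herglotz (weight φ) z + κ) = c)
    {ν ρ : Measure Circle} [IsFiniteMeasure ν] [IsFiniteMeasure ρ]
    (hμ : μ = ν + (ρ + m.withDensity (μ.rnDeriv m))) :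
    ∃ u ∈ H2, (∀ n : ℕ, coeff u n = ∑ p ∈ Finset.HasAntidiagonal.antidiagonal n,
        coeff φ p.1 * ∫ ζ : Circle, star (ζ : ℂ) ^ p.2 ∂ν) ∧
      ∀ z, ‖z‖ < 1 → poissonExt u z = poissonExt φ z * cauchyT ν z := by
  have h2 : ∀ z, ‖z‖ < 1 → herglotz μ z =
      herglotz ν z + herglotz (ρ + m.withDensity (μ.rnDeriv m)) z := fun z hz =>
    (congrArg (fun τ => herglotz τ z) hμ).trans (herglotz_add _ _ hz)
  have hD : ∀ z, ‖z‖ < 1 →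
      herglotz ν z + herglotz (ρ + m.withDensity (μ.rnDeriv m)) z - κ ≠ 0 := fun z hz h0 => by
    have h1 := hrel z hz
    rw [h2 z hz, h0, zero_mul] at h1
    exact hc.ne (by exact_mod_cast h1)
  refine exists_mem_H2_mul_cauchyT_of_parallel (c := c) hφ hD (fun z hz => ?_)
  refine norm_sq_mul_le_of_parallel (re_herglotz_nonneg ν hz) hκ hc (hD z hz) ?_
  have h1 := norm_sq_mul_le_poisson_rnDeriv hφ hκ hrel hz
  rw [h2 z hz] at h1
  -- Only the absolutely continuous part occurs in the bound `h1`, so adding the nonnegative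
  -- contribution of `ρ` is harmless. With `Re F` in its place the contribution of `ν` would remain.
  refine h1.trans (mul_le_mul_of_nonneg_left ?_ hc.le)
  rw [herglotz_add _ _ hz, add_re]
  linarith [re_herglotz_nonneg ρ hz]

end Estimate

/-! ### Cauchy transforms of singular measures as elements of `J_φ` -/

lemma mulPhi_coeFn (φ : L2) (η : Lp ℂ 2 (weight φ)) : mulPhi φ η =ᵐ[m] fun ζ => φ ζ * η ζ :=
  (memLp_mul_weight φ (fun ζ => φ ζ) (Lp.stronglyMeasurable φ) (fun _ => rfl) η).coeFn_toLp

lemma mulConjPhi_coeFn (φ : L2) (η : Lp ℂ 2 (weight φ)) :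
    mulConjPhi φ η =ᵐ[m] fun ζ => star (φ ζ) * η ζ :=
  (memLp_mul_weight φ (fun ζ => star (φ ζ)) (Lp.stronglyMeasurable φ).star
    (fun _ => norm_star _) η).coeFn_toLp

/-- If `ν` is singular and `φ` times its Cauchy transform belongs to `H²`, then the Cauchy
transform of `ν` belongs to `J_φ`. -/
lemma exists_mem_J_of_mul_cauchyT {φ : L2} (hφ : IsOuterH2 φ) {ν : Measure Circle}
    [IsFiniteMeasure ν] (hν : ν ⟂ₘ m) {u : L2} (hu : u ∈ H2)
    (hu0 : coeff u 0 = coeff φ 0 * ν.real Set.univ)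
    (hue : ∀ z, ‖z‖ < 1 → poissonExt u z = poissonExt φ z * cauchyT ν z) :
    ∃ η ∈ J φ, mulPhi φ η = u := by
  set N := ν.real Set.univ
  have hφ0 := hφ.ae_ne_zero
  have hhm : Measurable (fun ζ => u ζ / φ ζ) :=
    (Lp.stronglyMeasurable u).measurable.div (Lp.stronglyMeasurable φ).measurable
  have hhu : (fun ζ => φ ζ * (u ζ / φ ζ)) =ᵐ[m] u := by
    filter_upwards [hφ0] with ζ hζ
    field_simp
  have hh : MemLp (fun ζ => u ζ / φ ζ) 2 (weight φ) := by
    refine ⟨hhm.aestronglyMeasurable, ?_⟩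
    rw [← eLpNorm_mul_weight φ (fun ζ => φ ζ) _ (fun _ => rfl), eLpNorm_congr_ae hhu]
    exact Lp.eLpNorm_lt_top u
  have hη : ∀ᵐ ζ ∂m, hh.toLp _ ζ = u ζ / φ ζ := by
    filter_upwards [ae_mul_of_ae_weight hh.coeFn_toLp, hφ0] with ζ h1 h2 using h1 h2
  have hPhi : mulPhi φ (hh.toLp _) = u := by
    refine Lp.ext ?_
    filter_upwards [mulPhi_coeFn φ (hh.toLp _), hη, hhu] with ζ h1 h2 h3
    rw [h1, h2, h3]
  obtain ⟨r, hr⟩ := exists_isRadii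
  obtain ⟨n1, hn1, t1⟩ := hr.exists_subseq_poissonExt (integrable_L2 φ)
  obtain ⟨n2, hn2, t2⟩ := (hr.comp hn1).exists_subseq_poissonExt (integrable_L2 u)
  obtain ⟨n3, hn3, t3⟩ := ((hr.comp hn1).comp hn2).exists_subseq_herglotz hν
  have hr3 := ((hr.comp hn1).comp hn2).comp hn3
  -- In the disc `2 Re C_ν = Re F_ν + N`, and singularity of `ν` makes `Re F_ν` vanish on the
  -- boundary.
  have hre : ∀ᵐ ζ ∂m, 2 * (u ζ / φ ζ).re = N := by
    filter_upwards [t1, t2, t3, hφ0] with ζ t1 t2 t3 h0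
    have s1 := (t1.comp hn2.tendsto_atTop).comp hn3.tendsto_atTop
    have s2 := t2.comp hn3.tendsto_atTop
    have s3 := ((continuous_re.tendsto _).comp (s2.div s1 h0)).const_mul 2
    have s4 := t3.add_const N
    rw [zero_add] at s4
    refine tendsto_nhds_unique s3 (s4.congr' ?_)
    filter_upwards [s1.eventually_ne h0] with n hn
    have hz := hr3.norm_dil_lt n ζ
    change (herglotz ν (dil ((((r ∘ n1) ∘ n2) ∘ n3) n) ζ)).re + N =
      2 * (poissonExt u (dil ((((r ∘ n1) ∘ n2) ∘ n3) n) ζ) /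
      poissonExt φ (dil ((((r ∘ n1) ∘ n2) ∘ n3) n) ζ)).re
    change poissonExt φ (dil ((((r ∘ n1) ∘ n2) ∘ n3) n) ζ) ≠ 0 at hn
    rw [hue _ hz, mul_div_cancel_left₀ _ hn, herglotz_eq_cauchyT ν hz]
    simp [N]
  refine ⟨hh.toLp _, ⟨?_, fun k hk => ?_⟩, hPhi⟩
  · change mulPhi φ (hh.toLp _) ∈ H2
    rwa [hPhi]
  · change coeff (mulConjPhi φ (hh.toLp _)) k = 0
    -- Since `η + \bar η = N` on the circle, `\bar φ η` is the conjugate of `N φ - u`. This function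
    -- is in `H²`, and its coefficient of index zero vanishes by `hu0`.
    have e : mulConjPhi φ (hh.toLp _) =ᵐ[m] fun ζ => star (((N : ℂ) • φ - u : L2) ζ) := by
      filter_upwards [mulConjPhi_coeFn φ (hh.toLp _), hη, hre, hφ0,
        Lp.coeFn_sub ((N : ℂ) • φ) u, Lp.coeFn_smul (N : ℂ) φ] with ζ h1 h2 h3 h4 h5 h6
      rw [h1, h2, h5, Pi.sub_apply, h6, Pi.smul_apply, smul_eq_mul]
      have h7 : (N : ℂ) = u ζ / φ ζ + star (u ζ / φ ζ) := by
        have := Complex.add_conj (u ζ / φ ζ)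
        rw [← h3]; exact this.symm
      have h8 : (N : ℂ) * φ ζ - u ζ = φ ζ * star (u ζ / φ ζ) := by
        rw [h7]; field_simp; ring
      rw [h8, star_mul', star_star]
    rw [coeff_congr e, coeff_star]
    have h1 : coeff ((N : ℂ) • φ - u : L2) (-k) = N * coeff φ (-k) - coeff u (-k) := by
      rw [sub_eq_add_neg, ← neg_one_smul ℂ u, coeff_add, coeff_smul, coeff_smul]; ring
    rw [h1]
    rcases hk.eq_or_lt with h | h
    · rw [← h, neg_zero, hu0]; simp [mul_comm, N]
    · have hφH : ∀ n : ℤ, n < 0 → coeff φ n = 0 := hφ.mem_H2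
      rw [hφH _ (by omega), hu _ (by omega)]; simp

/-! ### The Aleksandrov–Clark measures and the Herglotz transform of the weight -/

lemma re_herglotz_pos (μ : Measure Circle) [IsProbabilityMeasure μ] {z : ℂ} (hz : ‖z‖ < 1) :
    0 < (herglotz μ z).re := by
  rw [re_herglotz μ hz, integral_pos_iff_support_of_nonneg
    (fun ξ => (poissonKernel_circle_pos ξ hz).le)
    (integrable_continuous (continuous_poissonKernel hz))]
  have : Function.support (fun ξ : Circle => poissonKernel 0 z (ξ : ℂ)) = Set.univ :=
    Set.eq_univ_of_forall fun ξ => (poissonKernel_circle_pos ξ hz).ne'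
  rw [this]; simp

lemma herglotz_weight_add_one_ne (φ : L2) {z : ℂ} (hz : ‖z‖ < 1) :
    herglotz (weight φ) z + 1 ≠ 0 := fun h => by
  have h1 := congrArg Complex.re h
  have h2 := re_herglotz_nonneg (weight φ) hz
  rw [add_re, one_re, zero_re] at h1
  linarith

lemma IsAleksandrovClark.herglotz_mul_eq {φ : L2} {α : Circle} {μ : Measure Circle}
    (h : IsAleksandrovClark (bFun φ) α μ) {z : ℂ} (hz : ‖z‖ < 1) :
    herglotz μ z * ((herglotz (weight φ) z + 1) - star (α : ℂ) * (herglotz (weight φ) z - 1)) =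
      (herglotz (weight φ) z + 1) + star (α : ℂ) * (herglotz (weight φ) z - 1) := by
  have := h.isProbabilityMeasure
  have h1 := h.herglotz_eq z (by simpa using hz)
  have h2 := herglotz_weight_add_one_ne φ hz
  have h3 : 1 - star (α : ℂ) * bFun φ z ≠ 0 := fun h0 => by
    rw [h0, div_zero] at h1
    have := re_herglotz_pos μ hz
    rw [← h1] at this
    simp at this
  rw [div_eq_iff h3] at h1
  have h4 : bFun φ z * (herglotz (weight φ) z + 1) = herglotz (weight φ) z - 1 :=
    div_mul_cancel₀ _ h2
  rw [← h4]
  linear_combination (-(herglotz (weight φ) z + 1)) * h1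

/-- Put `a = \bar α` and `κ = (1 + a) / (1 - a)`, which is imaginary because `|a| = 1`. Eliminating
`b` gives `F = (κ B + 1) / (B + κ)`, hence `F - κ = (1 - κ²) / (B + κ)` and `c = 1 - κ² = 1 + (Im
κ)²`. -/
lemma IsAleksandrovClark.exists_mul_eq {φ : L2} {α : Circle} (hα : α ≠ 1) {μ : Measure Circle}
    (h : IsAleksandrovClark (bFun φ) α μ) :
    ∃ (κ : ℂ) (c : ℝ), κ.re = 0 ∧ 0 < c ∧
      ∀ z, ‖z‖ < 1 → (herglotz μ z - κ) * (herglotz (weight φ) z + κ) = c := by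
  obtain ⟨a, ha⟩ : ∃ a : ℂ, a = star (α : ℂ) := ⟨_, rfl⟩
  have hαa : star a * a = 1 := by
    rw [ha, star_star, mul_comm]; exact star_mul_coe α
  have ha1 : 1 - a ≠ 0 := fun h0 => hα (by
    have h1 : star a = 1 := by rw [← sub_eq_zero.1 h0, star_one]
    rw [ha, star_star] at h1
    exact Circle.ext h1)
  have ha1' : 1 - star a ≠ 0 := fun h0 => ha1 (by
    have h1 := congrArg star h0
    rwa [star_sub, star_star, star_one, star_zero] at h1)
  have hκ : star ((1 + a) / (1 - a)) = -((1 + a) / (1 - a)) := by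
    rw [star_div₀, star_add, star_sub, star_one, ← neg_div, div_eq_div_iff ha1' ha1]
    linear_combination (-2 : ℂ) * hαa
  have hre : ((1 + a) / (1 - a)).re = 0 := by
    have h1 := congrArg Complex.re hκ
    rw [neg_re, show (star ((1 + a) / (1 - a))).re = ((1 + a) / (1 - a)).re from conj_re _] at h1
    linarith
  refine ⟨(1 + a) / (1 - a), 1 + ((1 + a) / (1 - a)).im ^ 2, hre, by positivity,
    fun z hz => ?_⟩
  have h1 := h.herglotz_mul_eq hz
  rw [← ha] at h1
  have h2 : ((1 + ((1 + a) / (1 - a)).im ^ 2 : ℝ) : ℂ) = 1 - ((1 + a) / (1 - a)) ^ 2 := by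
    have h3 : (1 + a) / (1 - a) = (((1 + a) / (1 - a)).im : ℂ) * I := by
      have := Complex.re_add_im ((1 + a) / (1 - a))
      rw [hre, ofReal_zero, zero_add] at this
      exact this.symm
    conv_rhs => rw [h3, mul_pow, I_sq]
    push_cast; ring
  rw [h2]
  field_simp
  linear_combination (1 - a) * h1

lemma singularPart_eq_zero_of_eq_one {φ : L2} {μ : Measure Circle}
    (h : IsAleksandrovClark (bFun φ) 1 μ) : μ.singularPart m = 0 := by
  have := h.isProbabilityMeasure
  have h1 : μ = weight φ := eq_of_herglotz_eq fun z hz => by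
    have := h.herglotz_mul_eq hz
    simp only [Circle.coe_one, star_one, one_mul] at this
    linear_combination this / 2
  rw [h1]
  exact Measure.singularPart_withDensity _ _

/-! ### Elements of `J_φ` represented by Cauchy transforms of densities -/

/-- `η ∈ J_φ` is the Cauchy transform of the complex measure `f dτ`. -/
def Represents (φ : L2) (τ : Measure Circle) (f : Circle → ℂ) (η : Lp ℂ 2 (weight φ)) : Prop :=
  η ∈ J φ ∧ ∀ n : ℕ, coeff (mulPhi φ η) n = ∑ p ∈ Finset.HasAntidiagonal.antidiagonal n,
    coeff φ p.1 * ∫ ζ : Circle, star (ζ : ℂ) ^ p.2 * f ζ ∂τ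

lemma integrable_star_pow_mul {τ : Measure Circle} {f : Circle → ℂ} (hf : Integrable f τ)
    (j : ℕ) : Integrable (fun ζ : Circle => star (ζ : ℂ) ^ j * f ζ) τ :=
  integrable_continuous_mul ((continuous_star.comp continuous_circle_coe).pow j) hf

lemma Represents.add {φ : L2} {τ : Measure Circle} {f g : Circle → ℂ} {η θ : Lp ℂ 2 (weight φ)}
    (h : Represents φ τ f η) (k : Represents φ τ g θ) (hf : Integrable f τ)
    (hg : Integrable g τ) : Represents φ τ (fun ζ => f ζ + g ζ) (η + θ) := by
  refine ⟨(J φ).add_mem h.1 k.1, fun n => ?_⟩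
  rw [map_add, coeff_add, h.2, k.2, ← Finset.sum_add_distrib]
  refine Finset.sum_congr rfl (fun p _ => ?_)
  simp_rw [mul_add]
  rw [integral_add (integrable_star_pow_mul hf _) (integrable_star_pow_mul hg _), mul_add]

lemma Represents.smul {φ : L2} {τ : Measure Circle} {f : Circle → ℂ} {η : Lp ℂ 2 (weight φ)}
    (h : Represents φ τ f η) (c : ℂ) : Represents φ τ (fun ζ => c * f ζ) (c • η) := by
  refine ⟨(J φ).smul_mem c h.1, fun n => ?_⟩
  rw [map_smul, coeff_smul, h.2, Finset.mul_sum]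
  refine Finset.sum_congr rfl (fun p _ => ?_)
  simp_rw [mul_left_comm _ c]
  rw [integral_const_mul, mul_left_comm]

lemma Represents.congr_ae {φ : L2} {τ : Measure Circle} {f g : Circle → ℂ}
    {η : Lp ℂ 2 (weight φ)} (h : Represents φ τ f η) (hfg : f =ᵐ[τ] g) :
    Represents φ τ g η := by
  refine ⟨h.1, fun n => (h.2 n).trans (Finset.sum_congr rfl fun p _ => congrArg _ ?_)⟩
  refine integral_congr_ae ?_
  filter_upwards [hfg] with ζ hζ
  rw [hζ]

lemma Represents.unique {φ : L2} {τ : Measure Circle} {f : Circle → ℂ}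
    {η θ : Lp ℂ 2 (weight φ)} (h : Represents φ τ f η) (k : Represents φ τ f θ) : η = θ := by
  rw [← sub_eq_zero]
  refine (mulPhi φ).injective ?_
  rw [map_zero]
  refine eq_zero_of_coeff_eq_zero ((J φ).sub_mem h.1 k.1).1 (fun n => ?_)
  rw [map_sub, sub_eq_add_neg, ← neg_one_smul ℂ (mulPhi φ θ), coeff_add, coeff_smul, h.2, k.2]
  ring

lemma Represents.evalZero_eq {φ : L2} (hφ : IsOuterH2 φ) {τ : Measure Circle} {f : Circle → ℂ}
    {η : Lp ℂ 2 (weight φ)} (h : Represents φ τ f η) : evalZero φ η = ∫ ζ, f ζ ∂τ := by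
  have h1 : evalZero φ η = (poissonExt φ 0)⁻¹ * poissonExt (mulPhi φ η) 0 := rfl
  have h2 := hφ.poissonExt_zero_ne
  have h3 := h.2 0
  simp only [Finset.Nat.antidiagonal_zero, Finset.sum_singleton, pow_zero, one_mul,
    Nat.cast_zero] at h3
  rw [h1, poissonExt_zero (mulPhi φ η), h3, ← poissonExt_zero φ, inv_mul_cancel_left₀ h2]

/-- The value at the origin is `∫ f dτ`, so subtracting it removes exactly the moment of order zero
from the Cauchy product; every other moment loses one factor `\bar ζ`, which passes to the density.
-/
lemma Represents.shift {φ : L2} (hφ : IsOuterH2 φ) {τ : Measure Circle} {f : Circle → ℂ}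
    {η : Lp ℂ 2 (weight φ)} (h : Represents φ τ f η) :
    Represents φ τ (fun ζ => star (ζ : ℂ) * f ζ) (shiftAux φ η) := by
  refine ⟨shiftAux_mem_J hφ h.1, fun n => ?_⟩
  have h1 : coeff (mulPhi φ η) ((n : ℤ) + 1) = _ := h.2 (n + 1)
  rw [mulPhi, coeff_mulWeight_shiftAux, ← mulPhi, h1, h.evalZero_eq hφ,
    Finset.Nat.sum_antidiagonal_succ']
  simp only [pow_zero, one_mul, Nat.cast_add, Nat.cast_one]
  rw [mul_comm (∫ ζ, f ζ ∂τ), add_sub_cancel_left]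
  refine Finset.sum_congr rfl (fun p _ => ?_)
  simp_rw [pow_succ, mul_assoc]

/-- The range `0 ≤ f ≤ 1` allows the splitting of the singular part into the positive measures `f
d(μ_α)_s` and `(1 - f) d(μ_α)_s`, the roles of `ν` and `ρ` in `exists_mem_H2_mul_cauchyT`. -/
lemma exists_represents_of_mem_unitInterval {φ : L2} (hφ : IsOuterH2 φ) {α : Circle} (hα : α ≠ 1)
    {μ : Measure Circle} (h : IsAleksandrovClark (bFun φ) α μ) {f : Circle → ℝ}
    (hf : Measurable f) (h0 : ∀ ζ, 0 ≤ f ζ) (h1 : ∀ ζ, f ζ ≤ 1) :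
    ∃ η, Represents φ (μ.singularPart m) (fun ζ => (f ζ : ℂ)) η := by
  have := h.isProbabilityMeasure
  obtain ⟨κ, c, hκ, hc, hrel⟩ := h.exists_mul_eq hα
  have hfm : Measurable fun ζ => ENNReal.ofReal (f ζ) := hf.ennreal_ofReal
  set s := μ.singularPart m
  set ν := s.withDensity fun ζ => ENNReal.ofReal (f ζ) with hν
  set ρ := s.withDensity fun ζ => ENNReal.ofReal (1 - f ζ) with hρ
  have hsum : ν + ρ = s := by
    rw [hν, hρ, ← withDensity_add_left hfm]
    have : ((fun ζ => ENNReal.ofReal (f ζ)) + fun ζ => ENNReal.ofReal (1 - f ζ)) = 1 := by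
      funext ζ
      rw [Pi.add_apply, ← ENNReal.ofReal_add (h0 ζ) (by linarith [h1 ζ])]
      simp
    rw [this, withDensity_one]
  have : IsFiniteMeasure ν := isFiniteMeasure_of_le s (hsum ▸ Measure.le_add_right le_rfl)
  have : IsFiniteMeasure ρ := isFiniteMeasure_of_le s (hsum ▸ Measure.le_add_left le_rfl)
  have hνm : ν ⟂ₘ m := (μ.mutuallySingular_singularPart m).mono_ac
    (withDensity_absolutelyContinuous _ _) Measure.AbsolutelyContinuous.rfl
  have hμ : μ = ν + (ρ + m.withDensity (μ.rnDeriv m)) := by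
    rw [← add_assoc, hsum]
    exact μ.haveLebesgueDecomposition_add m
  obtain ⟨u, hu, huc, hue⟩ := exists_mem_H2_mul_cauchyT hφ.mem_H2 hκ hc hrel hμ
  obtain ⟨η, hη, hηu⟩ := exists_mem_J_of_mul_cauchyT hφ hνm hu (by
    have := huc 0
    simpa using this) hue
  refine ⟨η, hη, fun n => ?_⟩
  rw [hηu, huc n]
  refine Finset.sum_congr rfl fun p _ => congrArg _ ?_
  rw [hν, integral_withDensity_eq_integral_toReal_smul hfm
    (by filter_upwards with ζ; exact ENNReal.ofReal_lt_top)]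
  congr 1; ext ζ
  rw [ENNReal.toReal_ofReal (h0 ζ), Complex.real_smul, mul_comm]

lemma exists_represents_of_bounded {φ : L2} (hφ : IsOuterH2 φ) {α : Circle} (hα : α ≠ 1)
    {μ : Measure Circle} (h : IsAleksandrovClark (bFun φ) α μ) {f : Circle → ℂ}
    (hf : Measurable f) {M : ℝ} (hM : 0 < M) (hfM : ∀ ζ, ‖f ζ‖ ≤ M) :
    ∃ η, Represents φ (μ.singularPart m) f η := by
  have := h.isProbabilityMeasure
  have key : ∀ g : Circle → ℝ, Measurable g → (∀ ζ, |g ζ| ≤ M) →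
      ∃ η, Represents φ (μ.singularPart m) (fun ζ => (g ζ : ℂ)) η := by
    intro g hg hgM
    -- An affine change brings `g` into the unit interval; `g = 2M · (g + M) / (2M) - M · 1` undoes
    -- it by linearity.
    obtain ⟨η, hη⟩ := exists_represents_of_mem_unitInterval hφ hα h
      (f := fun ζ => (g ζ + M) / (2 * M)) ((hg.add_const M).div_const _)
      (fun ζ => div_nonneg (by linarith [(abs_le.1 (hgM ζ)).1]) (by linarith))
      (fun ζ => by rw [div_le_one (by linarith)]; linarith [(abs_le.1 (hgM ζ)).2])
    obtain ⟨θ, hθ⟩ := exists_represents_of_mem_unitInterval hφ hα h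
      (f := fun _ => 1) measurable_const (fun _ => zero_le_one) (fun _ => le_rfl)
    have hi : Integrable (fun ζ => (((g ζ + M) / (2 * M) : ℝ) : ℂ)) (μ.singularPart m) := by
      refine (Integrable.of_bound (C := 1) ?_ ?_)
      · exact (measurable_ofReal.comp ((hg.add_const M).div_const _)).aestronglyMeasurable
      · filter_upwards with ζ
        rw [Complex.norm_real, Real.norm_eq_abs, abs_le, le_div_iff₀ (by linarith),
          div_le_one (by linarith)]
        have := abs_le.1 (hgM ζ)
        constructor <;> linarith
    refine ⟨(2 * M : ℂ) • η + (-M : ℂ) • θ,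
      ((hη.smul (2 * M)).add (hθ.smul (-M)) (hi.const_mul _)
        ((integrable_const _).const_mul _)).congr_ae ?_⟩
    filter_upwards with ζ
    have : (M : ℂ) ≠ 0 := by exact_mod_cast hM.ne'
    push_cast
    field_simp
    ring
  obtain ⟨η, hη⟩ := key (fun ζ => (f ζ).re) (measurable_re.comp hf)
    (fun ζ => (abs_re_le_norm _).trans (hfM ζ))
  obtain ⟨θ, hθ⟩ := key (fun ζ => (f ζ).im) (measurable_im.comp hf)
    (fun ζ => (abs_im_le_norm _).trans (hfM ζ))
  have hi : Integrable f (μ.singularPart m) :=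
    Integrable.of_bound (C := M) hf.aestronglyMeasurable (by filter_upwards with ζ; exact hfM ζ)
  refine ⟨η + I • θ, (hη.add (hθ.smul I) hi.re.ofReal (hi.im.ofReal.const_mul _)).congr_ae ?_⟩
  filter_upwards with ζ
  rw [mul_comm]
  exact Complex.re_add_im (f ζ)

lemma exists_represents_restrict {φ : L2} (hφ : IsOuterH2 φ) {α : Circle} (hα : α ≠ 1)
    {μ : Measure Circle} (h : IsAleksandrovClark (bFun φ) α μ) {A : Set Circle}
    (hA : MeasurableSet A) {f : Circle → ℂ} (hf : Measurable f) {M : ℝ} (hM : 0 < M)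
    (hfM : ∀ ζ ∈ A, ‖f ζ‖ ≤ M) :
    ∃ η, Represents φ ((μ.singularPart m).restrict A) f η := by
  obtain ⟨η, hη⟩ := exists_represents_of_bounded hφ hα h (hf.indicator hA) hM (fun ζ => by
    by_cases hζ : ζ ∈ A
    · rw [Set.indicator_of_mem hζ]; exact hfM ζ hζ
    · rw [Set.indicator_of_notMem hζ, norm_zero]; exact hM.le)
  refine ⟨η, hη.1, fun n => (hη.2 n).trans (Finset.sum_congr rfl fun p _ => congrArg _ ?_)⟩
  rw [← integral_indicator hA]
  congr 1; ext ζ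
  by_cases hζ : ζ ∈ A <;> simp [hζ]

/-! ### The Cauchy integral of a measure off its carrier -/

lemma differentiableAt_integral_inv {τ : Measure Circle} [IsFiniteMeasure τ] {w : ℂ} {δ : ℝ}
    (hδ : 0 < δ) (h : ∀ᵐ ζ : Circle ∂τ, 2 * δ ≤ ‖star (ζ : ℂ) - w‖) :
    DifferentiableAt ℂ (fun w => ∫ ζ : Circle, (star (ζ : ℂ) - w)⁻¹ ∂τ) w := by
  have hm : ∀ v : ℂ, Measurable fun ζ : Circle => (star (ζ : ℂ) - v)⁻¹ := fun v =>
    ((continuous_star.comp continuous_circle_coe).sub continuous_const).measurable.inv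
  have hb : ∀ᵐ ζ : Circle ∂τ, ∀ v ∈ ball w δ, δ ≤ ‖star (ζ : ℂ) - v‖ := by
    filter_upwards [h] with ζ hζ v hv
    have h1 : ‖star (ζ : ℂ) - w‖ ≤ ‖star (ζ : ℂ) - v‖ + ‖v - w‖ := by
      simpa using norm_add_le (star (ζ : ℂ) - v) (v - w)
    have h2 : ‖v - w‖ < δ := by rwa [← dist_eq_norm]
    linarith
  refine (hasDerivAt_integral_of_dominated_loc_of_deriv_le (μ := τ)
    (F := fun v (ζ : Circle) => (star (ζ : ℂ) - v)⁻¹)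
    (F' := fun v (ζ : Circle) => ((star (ζ : ℂ) - v)⁻¹) ^ 2) (bound := fun _ => (δ⁻¹) ^ 2)
    (ball_mem_nhds w hδ) (Eventually.of_forall fun v => (hm v).aestronglyMeasurable) ?_
    ((hm w).pow_const 2).aestronglyMeasurable ?_ (integrable_const _) ?_).2.differentiableAt
  · refine Integrable.of_bound (C := δ⁻¹) (hm w).aestronglyMeasurable ?_
    filter_upwards [hb] with ζ hζ
    rw [norm_inv]
    exact inv_anti₀ hδ (hζ w (mem_ball_self hδ))
  · filter_upwards [hb] with ζ hζ v hv
    rw [norm_pow, norm_inv]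
    exact pow_le_pow_left₀ (by positivity) (inv_anti₀ hδ (hζ v hv)) 2
  · filter_upwards [hb] with ζ hζ v hv
    have hne : star (ζ : ℂ) - v ≠ 0 := norm_pos_iff.1 (hδ.trans_le (hζ v hv))
    have := ((hasDerivAt_id v).const_sub (star (ζ : ℂ))).inv hne
    refine this.congr_deriv ?_
    rw [neg_neg, inv_pow, one_div]
    rfl

lemma norm_integral_inv_le {τ : Measure Circle} [IsFiniteMeasure τ] {w : ℂ} (hw : 1 < ‖w‖) :
    ‖∫ ζ : Circle, (star (ζ : ℂ) - w)⁻¹ ∂τ‖ ≤ (‖w‖ - 1)⁻¹ * τ.real Set.univ := by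
  refine norm_integral_le_of_norm_le_const ?_
  filter_upwards with ζ
  rw [norm_inv]
  refine inv_anti₀ (by linarith) ?_
  have := norm_sub_norm_le w (star (ζ : ℂ))
  rw [norm_star, Circle.norm_coe, norm_sub_rev] at this
  exact this

/-- The integral is `-w⁻¹` times the Cauchy transform of `τ` at `w⁻¹`. A zero there would make the
Herglotz transform equal to minus the total mass, against the nonnegativity of its real part. -/
lemma integral_inv_ne_zero {τ : Measure Circle} [IsFiniteMeasure τ] (hτ : τ ≠ 0) {w : ℂ}
    (hw : 1 < ‖w‖) : ∫ ζ : Circle, (star (ζ : ℂ) - w)⁻¹ ∂τ ≠ 0 := by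
  intro h0
  have hw0 : w ≠ 0 := norm_pos_iff.1 (zero_lt_one.trans hw)
  have hz : ‖w⁻¹‖ < 1 := by rw [norm_inv]; exact inv_lt_one_of_one_lt₀ hw
  have h1 : ∀ ζ : Circle, (star (ζ : ℂ) - w)⁻¹ = -w⁻¹ * (1 - star (ζ : ℂ) * w⁻¹)⁻¹ := fun ζ => by
    rw [← inv_neg, ← mul_inv]
    congr 1
    field_simp
    ring
  simp_rw [h1] at h0
  rw [integral_const_mul] at h0
  have h2 : cauchyT τ w⁻¹ = 0 := (mul_eq_zero.1 h0).resolve_left (by simpa using hw0)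
  have h3 := re_herglotz_nonneg τ hz
  rw [herglotz_eq_cauchyT τ hz, h2, mul_zero, zero_sub, neg_re, ofReal_re] at h3
  have h4 : 0 < τ.real Set.univ := by
    rw [measureReal_def]
    exact ENNReal.toReal_pos (by simpa using hτ) (measure_ne_top _ _)
  linarith

/-! ### The main theorem -/

/-- On densities `L - w` multiplies by `\bar ζ - w`, so it sends `θ` to `η`. As the resolvent is the
inverse of `w - L`, it sends `η` to `-θ`, whose value at the origin is minus the integral of its
density. -/
lemma evalZero_resolvent_eq {φ : L2} (hφ : IsOuterH2 φ) {τ : Measure Circle} [IsFiniteMeasure τ]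
    {w : ℂ} (hw : w ∈ resolventSet ℂ (backwardShift φ hφ)) {η : J φ}
    (hη : Represents φ τ (fun _ => 1) η) {θ : Lp ℂ 2 (weight φ)}
    (hθ : Represents φ τ (fun ζ => (star (ζ : ℂ) - w)⁻¹) θ)
    (hi : Integrable (fun ζ : Circle => (star (ζ : ℂ) - w)⁻¹) τ)
    (hne : ∀ᵐ ζ : Circle ∂τ, star (ζ : ℂ) - w ≠ 0) :
    evalZero φ (resolvent (backwardShift φ hφ) w η : J φ) =
      -∫ ζ : Circle, (star (ζ : ℂ) - w)⁻¹ ∂τ := by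
  have h1 : Represents φ τ (fun _ => 1) (shiftAux φ θ + (-w) • θ) := by
    refine ((hθ.shift hφ).add (hθ.smul (-w)) ?_ (hi.const_mul _)).congr_ae ?_
    · simpa using integrable_star_pow_mul hi 1
    · filter_upwards [hne] with ζ hζ
      rw [← add_mul, ← sub_eq_add_neg, mul_inv_cancel₀ hζ]
  have h2 : ((algebraMap ℂ (J φ →L[ℂ] J φ) w - backwardShift φ hφ) ⟨θ, hθ.1⟩ : J φ) = -η := by
    refine Subtype.ext ?_
    have e : (η : Lp ℂ 2 (weight φ)) = shiftAux φ θ + (-w) • θ := hη.unique h1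
    change w • θ - shiftAux φ θ = -(η : Lp ℂ 2 (weight φ))
    rw [e, neg_smul]; abel
  have h3 : resolvent (backwardShift φ hφ) w *
      (algebraMap ℂ (J φ →L[ℂ] J φ) w - backwardShift φ hφ) = 1 :=
    Ring.inverse_mul_cancel _ hw
  have h4 : (resolvent (backwardShift φ hφ) w) (-η) = ⟨θ, hθ.1⟩ := by
    rw [← h2]
    exact congrArg (fun T : J φ →L[ℂ] J φ => T ⟨θ, hθ.1⟩) h3
  rw [map_neg] at h4
  have h5 : ((resolvent (backwardShift φ hφ) w η : J φ) : Lp ℂ 2 (weight φ)) = -θ := by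
    rw [neg_eq_iff_eq_neg.1 h4]; rfl
  rw [h5, map_neg, hθ.evalZero_eq hφ]

lemma differentiableAt_resolvent_apply {E : Type*} [NormedAddCommGroup E] [NormedSpace ℂ E]
    [CompleteSpace E] (T : E →L[ℂ] E) (l : E →L[ℂ] ℂ) (x : E) {w : ℂ}
    (hw : w ∈ resolventSet ℂ T) : DifferentiableAt ℂ (fun w => l (resolvent T w x)) w :=
  (l.comp (ContinuousLinearMap.apply ℂ E x)).differentiableAt.comp w
    (spectrum.hasDerivAt_resolvent_const_left hw).differentiableAt

/-- A restriction of the singular part of an Aleksandrov–Clark measure whose conjugate is carried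
by a disc in the resolvent set of the backward shift vanishes. -/
lemma restrict_singularPart_eq_zero {φ : L2} (hφ : IsOuterH2 φ) {α : Circle} (hα : α ≠ 1)
    {μ : Measure Circle} (h : IsAleksandrovClark (bFun φ) α μ) {w₀ : ℂ} {ε : ℝ}
    (hball : closedBall w₀ ε ⊆ resolventSet ℂ (backwardShift φ hφ)) :
    (μ.singularPart m).restrict {ζ : Circle | star (ζ : ℂ) ∈ closedBall w₀ ε} = 0 := by
  have := h.isProbabilityMeasure
  by_contra hτ
  have hA : MeasurableSet {ζ : Circle | star (ζ : ℂ) ∈ closedBall w₀ ε} :=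
    (isClosed_closedBall.preimage (continuous_star.comp continuous_circle_coe)).measurableSet
  set A := {ζ : Circle | star (ζ : ℂ) ∈ closedBall w₀ ε}
  set τ := (μ.singularPart m).restrict A
  have hτA : ∀ᵐ ζ ∂τ, ζ ∈ A := ae_restrict_mem hA
  have hdist : ∀ w ∉ closedBall w₀ ε, 0 < (dist w w₀ - ε) / 2 ∧
      ∀ ζ ∈ A, 2 * ((dist w w₀ - ε) / 2) ≤ ‖star (ζ : ℂ) - w‖ := by
    intro w hw
    rw [mem_closedBall, not_le] at hw
    refine ⟨by linarith, fun ζ hζ => ?_⟩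
    have h1 : dist (star (ζ : ℂ)) w₀ ≤ ε := hζ
    have h2 := dist_triangle w (star (ζ : ℂ)) w₀
    have h3 : dist w (star (ζ : ℂ)) = ‖star (ζ : ℂ) - w‖ := by rw [dist_comm]; exact dist_eq_norm _ _
    linarith
  obtain ⟨η₀, hη₀⟩ := exists_represents_restrict hφ hα h hA (f := fun _ => 1) measurable_const
    one_pos (fun ζ _ => by simp)
  set η : J φ := ⟨η₀, hη₀.1⟩
  -- Off the disc the density `(\bar ζ - w)⁻¹` is bounded on `A`, so it is represented by an element
  -- of `J_φ`.
  have hoverlap : ∀ w ∈ resolventSet ℂ (backwardShift φ hφ), w ∉ closedBall w₀ ε →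
      evalZero φ (resolvent (backwardShift φ hφ) w η : J φ) =
        -∫ ζ : Circle, (star (ζ : ℂ) - w)⁻¹ ∂τ := by
    intro w hw hw'
    obtain ⟨hδ, hd⟩ := hdist w hw'
    have hδ2 : 0 < 2 * ((dist w w₀ - ε) / 2) := by linarith
    have hm : Measurable fun ζ : Circle => (star (ζ : ℂ) - w)⁻¹ :=
      ((continuous_star.comp continuous_circle_coe).sub continuous_const).measurable.inv
    have hb : ∀ ζ ∈ A, ‖(star (ζ : ℂ) - w)⁻¹‖ ≤ (2 * ((dist w w₀ - ε) / 2))⁻¹ := fun ζ hζ => by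
      rw [norm_inv]; exact inv_anti₀ hδ2 (hd ζ hζ)
    obtain ⟨θ, hθ⟩ := exists_represents_restrict hφ hα h hA hm (inv_pos.2 hδ2) hb
    refine evalZero_resolvent_eq hφ hw (η := η) hη₀ hθ
      (Integrable.of_bound (C := (2 * ((dist w w₀ - ε) / 2))⁻¹) hm.aestronglyMeasurable ?_) ?_
    · filter_upwards [hτA] with ζ hζ using hb ζ hζ
    · filter_upwards [hτA] with ζ hζ using norm_pos_iff.1 (hδ2.trans_le (hd ζ hζ))
  classical
  -- The resolvent formula fills in the disc. By `hoverlap` it is valid on the whole resolvent set,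
  -- an open neighbourhood of the disc, so the two pieces glue to an entire function.
  obtain ⟨E, hE⟩ : ∃ E : ℂ → ℂ, E = fun w => if w ∈ closedBall w₀ ε then
    -evalZero φ (resolvent (backwardShift φ hφ) w η : J φ) else
      ∫ ζ : Circle, (star (ζ : ℂ) - w)⁻¹ ∂τ := ⟨_, rfl⟩
  have hE1 : ∀ w ∈ resolventSet ℂ (backwardShift φ hφ),
      E w = -evalZero φ (resolvent (backwardShift φ hφ) w η : J φ) := fun w hw => by
    by_cases hw' : w ∈ closedBall w₀ ε
    · simp only [hE, if_pos hw']
    · simp only [hE, if_neg hw']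
      rw [hoverlap w hw hw', neg_neg]
  have hE2 : ∀ w ∉ closedBall w₀ ε, E w = ∫ ζ : Circle, (star (ζ : ℂ) - w)⁻¹ ∂τ :=
    fun w hw => by simp only [hE, if_neg hw]
  have hEd : Differentiable ℂ E := by
    intro w
    by_cases hw : w ∈ closedBall w₀ ε
    · have hw' := hball hw
      refine (differentiableAt_resolvent_apply _ ((evalZero φ).comp (J φ).subtypeL) η
        hw').neg.congr_of_eventuallyEq ?_
      filter_upwards [(spectrum.isOpen_resolventSet (𝕜 := ℂ) (backwardShift φ hφ)).mem_nhds hw']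
        with v hv using hE1 v hv
    · obtain ⟨hδ, hd⟩ := hdist w hw
      refine (differentiableAt_integral_inv (τ := τ) hδ ?_).congr_of_eventuallyEq ?_
      · filter_upwards [hτA] with ζ hζ using hd ζ hζ
      · filter_upwards [isClosed_closedBall.isOpen_compl.mem_nhds hw] with v hv using hE2 v hv
  have hfar : ∀ᶠ w in cocompact ℂ, w ∉ closedBall w₀ ε :=
    (isCompact_closedBall w₀ ε).compl_mem_cocompact
  have hlarge : ∀ᶠ w in cocompact ℂ, 1 < ‖w‖ :=
    (tendsto_norm_cocompact_atTop (E := ℂ)).eventually_gt_atTop 1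
  have hlim : Tendsto E (cocompact ℂ) (𝓝 0) := by
    have h1 : Tendsto (fun w : ℂ => (‖w‖ - 1)⁻¹ * τ.real Set.univ) (cocompact ℂ) (𝓝 0) := by
      have h2 := tendsto_atTop_add_const_right _ (-1 : ℝ)
        (tendsto_norm_cocompact_atTop (E := ℂ))
      simpa [sub_eq_add_neg] using (tendsto_inv_atTop_zero.comp h2).mul_const (τ.real Set.univ)
    refine squeeze_zero_norm' ?_ h1
    filter_upwards [hfar, hlarge] with w hw hw1
    rw [hE2 w hw]
    exact norm_integral_inv_le hw1
  -- By Liouville `E` is zero, but at a point outside both the disc and the closed unit disc it is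
  -- the nonvanishing Cauchy integral of `τ`.
  obtain ⟨w, hw, hw1⟩ := (hfar.and hlarge).exists
  refine integral_inv_ne_zero hτ hw1 ?_
  rw [← hE2 w hw]
  exact hEd.apply_eq_of_tendsto_cocompact w hlim

end

end ClarkExposure

theorem mainTheorem7 (φ : ClarkExposure.L2) (hφ : ClarkExposure.IsOuterH2 φ) (hnorm : ‖φ‖ = 1)
    (α : Circle) (μ : MeasureTheory.Measure Circle)
    (hμ : ClarkExposure.IsAleksandrovClark (ClarkExposure.bFun φ) α μ) :
    (fun ζ : Circle => (ζ : ℂ)) '' (μ.singularPart ClarkExposure.m).support ⊆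
      ClarkExposure.sigma φ hφ := by
  rintro _ ⟨ζ₀, hζ₀, rfl⟩
  -- The constant `κ` has a pole at `α = 1`, so this case is settled separately by absolute
  -- continuity.
  by_cases hα : α = 1
  · subst hα
    rw [ClarkExposure.singularPart_eq_zero_of_eq_one hμ, Measure.support_zero] at hζ₀
    exact hζ₀.elim
  refine ⟨star (ζ₀ : ℂ), ?_, star_star _⟩
  by_contra hspec
  have hres : star (ζ₀ : ℂ) ∈ resolventSet ℂ (ClarkExposure.backwardShift φ hφ) :=
    not_not.1 hspec
  obtain ⟨ε, hε, hball⟩ := Metric.nhds_basis_closedBall.mem_iff.1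
    ((spectrum.isOpen_resolventSet (𝕜 := ℂ) (ClarkExposure.backwardShift φ hφ)).mem_nhds hres)
  have h0 := ClarkExposure.restrict_singularPart_eq_zero hφ hα hμ hball
  rw [Measure.restrict_eq_zero] at h0
  have hnhds : {ζ : Circle | star (ζ : ℂ) ∈ Metric.closedBall (star (ζ₀ : ℂ)) ε} ∈ nhds ζ₀ :=
    (continuous_star.comp ClarkExposure.continuous_circle_coe).continuousAt.preimage_mem_nhds
      (Metric.closedBall_mem_nhds _ hε)
  exact ((Measure.mem_support_iff_forall _).1 hζ₀ _ hnhds).ne' h0
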